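/- **Model.** Base stations (BSs) form a homogeneous Poisson point process $\Phi=\{b_i\}$ of density $\lambda>0$ on the plane; active users have density $\rho\in(0,\infty)$; the typical user is at the origin. The set of active BSs $\tilde\Phi\subseteq\Phi$ is modelled as a homogeneous Poisson process of density $$\tilde\lambda=\lambda\Bigl[1-\bigl(1+\tfrac{\rho}{q\lambda}\bigr)^{-q}\Bigr],\qquad q>0,$$ with no further restriction on the joint law of $(\Phi,\tilde\Phi)$. A BS at planar distance $r$ has 3D distance $w=\sqrt{r^2+L^2}$. Let $L<d_1<\dots<d_{N-1}$, $N\ge1$, and call $w$ in piece $n$ if $d_{n-1}<w\le d_n$ (piece $1$: $L\le w\le d_1$; piece $N$: $w>d_{N-1}$). In piece $n$ the link is line-of-sight (LoS) with probability $\mathrm{Pr}^{\rm L}(w)=\mathrm{Pr}^{\rm L}_n(w)\in[0,1]$, with path loss gain $\zeta^{\rm L}(w)=A^{\rm L}_nw^{-\alpha^{\rm L}_n}$, and otherwise has gain $\zeta^{\rm NL}(w)=A^{\rm NL}_nw^{-\alpha^{\rm NL}_n}$; all $A$'s and $\alpha$'s are positive and each $\mathrm{Pr}^{\rm L}_n$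 is monotonically decreasing (not necessarily strictly) on its piece. Assume $\mathrm{Pr}^{\rm L}_1(w)>0$ for some $w>L$ in the first piece, and that, with $\zeta_1^{\rm L}(L)=A_1^{\rm L}L^{-\alpha_1^{\rm L}}$, $\zeta^{\rm L}(w)\le\zeta_1^{\rm L}(L)$ and $\zeta^{\rm NL}(w)\le\zeta_1^{\rm L}(L)$ for all $w\ge L$ (no link is stronger than a LoS link of minimal length). LoS indicators are conditionally independent given $(\Phi,\tilde\Phi)$. The typical user is served by the BS $b_o\in\Phi$ with the largest gain $\zeta_o$. With i.i.d. mean-one exponential fadings $h,g_1,g_2,\dots$ independent of everything else, transmit power $P>0$, noise power $P_{\rm N}>0$, and $\beta_i$ the gain of the link from $b_i$, $$\mathrm{SINR}=\frac{P\zeta_oh}{\sum_{b_i\in\tilde\Phi\setminus\{b_o\}}P\beta_ig_i+P_{\rm N}}$$ (which is $0$ if the sum diverges). Let $p^{\rm cov}(\lambda,\rho,\gamma)=\Pr[\mathrm{SINR}>\gamma]$ and, with $f_\Gamma$ the probability density function of the SINR (on $(0,\infty)$), let $$A^{\rm ASE}(\lambda,\rho,\gamma_0)=\tilde\lambda\int_{\gamma_0}^\infty\log_2(1+\gamma)f_\Gamma(\lambda,\rho,\gamma)\,d\gamma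 .$$ **Theorem (constant capacity scaling law).** Let $L>0$, $0<\rho<\infty$ and $\gamma_0\ge0$. Then $\tilde\lambda\to\rho$ as $\lambda\to\infty$, and for every $\gamma>0$ $$\lim_{\lambda\to\infty}p^{\rm cov}(\lambda,\rho,\gamma)=p^\infty(\gamma):=e^{-\frac{P_{\rm N}\gamma}{P\zeta_1^{\rm L}(L)}}\exp\Bigl(-2\pi\rho\int_0^\infty\frac{\mathrm{Pr}^{\rm L}(w_u)\,u}{1+(sP\zeta^{\rm L}(w_u))^{-1}}du\Bigr)\exp\Bigl(-2\pi\rho\int_0^\infty\frac{[1-\mathrm{Pr}^{\rm L}(w_u)]\,u}{1+(sP\zeta^{\rm NL}(w_u))^{-1}}du\Bigr),$$ where $w_u=\sqrt{u^2+L^2}$, $s=\gamma/(P\zeta_1^{\rm L}(L))$ and $\exp(-\infty)=0$. The integral in the limit below and the one defining $A^{\rm ASE}$ (for every $\lambda>0$) converge, and the area spectral efficiency tends to a constant independent of $\lambda$: $$\lim_{\lambda\to\infty}A^{\rm ASE}(\lambda,\rho,\gamma_0)=\frac{\rho}{\ln2}\int_{\gamma_0}^\infty\frac{p^\infty(\gamma)}{1+\gamma}\,d\gamma+\rho\log_2(1+\gamma_0)\,p^\infty(\gamma_0)$$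 (the last term is $0$ if $\gamma_0=0$). -/

import Mathlib

open MeasureTheory ProbabilityTheory Filter Topology
open scoped ENNReal

noncomputable section

/-- The plane in which base stations (BSs) are deployed; the typical user (UE) sits at the origin. -/
abbrev Plane : Type := EuclideanSpace ℝ (Fin 2)

/-- Parameters of the radio model. There are `m + 1` pieces, separated by the break points
`d 0 < … < d (m - 1)`; the piece with index `n` (counted from `0`) has LoS gain
`AL n * w ^ (-αL n)`, NLoS gain `ANL n * w ^ (-αNL n)` and LoS probability `PrL n w`, where `w` is
the 3D distance. `L` is the antenna height difference, `P` the transmission power, `PN` the noise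
power and `q` the shape parameter in the density of active BSs. -/
structure RadioModel where
  m : ℕ
  d : Fin m → ℝ
  AL : Fin (m + 1) → ℝ
  ANL : Fin (m + 1) → ℝ
  αL : Fin (m + 1) → ℝ
  αNL : Fin (m + 1) → ℝ
  PrL : Fin (m + 1) → ℝ → ℝ
  L : ℝ
  P : ℝ
  PN : ℝ
  q : ℝ

namespace RadioModel

variable (M : RadioModel)

/-- The index of the piece that contains the distance `w`, i.e. the number of break points that are
strictly smaller than `w`: index `0` for `w ≤ d 0`, index `1` for `d 0 < w ≤ d 1`, and so on. -/
def piece (w : ℝ) : Fin (M.m + 1) :=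
  ⟨(Finset.univ.filter (fun i : Fin M.m => M.d i < w)).card,
    Nat.lt_succ_of_le ((Finset.card_le_univ _).trans (Fintype.card_fin M.m).le)⟩

/-- Piecewise LoS path loss function (a power gain). -/
def gainL (w : ℝ) : ℝ := M.AL (M.piece w) * w ^ (-M.αL (M.piece w))

/-- Piecewise NLoS path loss function (a power gain). -/
def gainNL (w : ℝ) : ℝ := M.ANL (M.piece w) * w ^ (-M.αNL (M.piece w))

/-- Piecewise LoS probability function. -/
def prLoS (w : ℝ) : ℝ := M.PrL (M.piece w) w

/-- First-piece LoS gain at the minimal possible 3D distance `L`. -/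
def peakGain : ℝ := M.AL 0 * M.L ^ (-M.αL 0)

/-- 3D distance for the 2D distance `r`. -/
def dist3 (r : ℝ) : ℝ := Real.sqrt (r ^ 2 + M.L ^ 2)

/-- Standing conditions on the parameters. -/
structure Admissible : Prop where
  d_mono : StrictMono M.d
  L_lt_d : ∀ i, M.L < M.d i
  AL_pos : ∀ n, 0 < M.AL n
  ANL_pos : ∀ n, 0 < M.ANL n
  αL_pos : ∀ n, 0 < M.αL n
  αNL_pos : ∀ n, 0 < M.αNL n
  P_pos : 0 < M.P
  PN_pos : 0 < M.PN
  q_pos : 0 < M.q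
  /-- LoS probabilities are probabilities, on all possible distances. -/
  prLoS_mem : ∀ w, M.L ≤ w → M.prLoS w ∈ Set.Icc (0 : ℝ) 1
  /-- Every piece of the LoS probability function is monotonically decreasing. -/
  PrL_anti : ∀ n, AntitoneOn (M.PrL n) {w | M.L ≤ w ∧ M.piece w = n}
  /-- LoS links exist at short distances (automatic if the first piece of the LoS probability
  function is strictly decreasing). -/
  PrL_pos : ∃ w, M.L < w ∧ M.piece w = 0 ∧ 0 < M.PrL 0 w
  /-- No link is stronger than a LoS link of minimal length. -/
  gainL_le : ∀ w, M.L ≤ w → M.gainL w ≤ M.peakGain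
  gainNL_le : ∀ w, M.L ≤ w → M.gainNL w ≤ M.peakGain

/-- Density of active BSs, `l` being the density of BSs and `ρ` the density of UEs. -/
def activeDensity (ρ l : ℝ) : ℝ := l * (1 - 1 / (1 + ρ / (M.q * l)) ^ M.q)

/-- `exp (-x)` for `x ∈ [0, ∞]`, with `exp (-∞) = 0`. -/
def expNeg (x : ℝ≥0∞) : ℝ := if x = ∞ then 0 else Real.exp (-x.toReal)

/-- The integral `∫₀^∞ p(w) u / (1 + (s P ζ(w))⁻¹) du` with `w = √(u² + L²)`, as an element of
`[0, ∞]`. The fraction `1 / (1 + x⁻¹)` is written as `x / (1 + x)`, so that it is `0` at `x = 0`. -/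
def interfIntegral (p ζ : ℝ → ℝ) (s : ℝ) : ℝ≥0∞ :=
  ∫⁻ u in Set.Ioi (0 : ℝ), ENNReal.ofReal
    (p (M.dist3 u) * u * (s * M.P * ζ (M.dist3 u) / (1 + s * M.P * ζ (M.dist3 u))))

/-- The limit of the Laplace transform of the aggregate interference. -/
def laplaceLimit (ρ s : ℝ) : ℝ :=
  expNeg (ENNReal.ofReal (2 * Real.pi * ρ) * M.interfIntegral M.prLoS M.gainL s) *
    expNeg (ENNReal.ofReal (2 * Real.pi * ρ) *
      M.interfIntegral (fun w => 1 - M.prLoS w) M.gainNL s)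

/-- The limiting coverage probability. -/
def coverageLimit (ρ γ : ℝ) : ℝ :=
  Real.exp (-(M.PN * γ / (M.P * M.peakGain))) * M.laplaceLimit ρ (γ / (M.P * M.peakGain))

end RadioModel

section PointProcess

variable {Ω : Type*} [MeasurableSpace Ω]

/-- Number of selected points in `B`. -/
def pointCount (b : ℕ → Ω → Plane) (sel : ℕ → Ω → Bool) (B : Set Plane) (ω : Ω) : ℕ∞ :=
  {i | sel i ω = true ∧ b i ω ∈ B}.encard

/-- The selected points form a homogeneous Poisson point process with density `dens`. -/
structure IsHPPP (μ : Measure Ω) (b : ℕ → Ω → Plane) (sel : ℕ → Ω → Bool) (dens : ℝ) : Prop where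
  poisson : ∀ B : Set Plane, MeasurableSet B → volume B ≠ ∞ → ∀ k : ℕ,
    μ {ω | pointCount b sel B ω = k} =
      poissonMeasure (dens * (volume B).toReal).toNNReal {k}
  indep : ∀ (n : ℕ) (B : Fin n → Set Plane), (∀ j, MeasurableSet (B j)) →
    Pairwise (fun j k => Disjoint (B j) (B k)) →
      iIndepFun (fun j => pointCount b sel (B j)) μ

end PointProcess

/-- The random variables of a network: `pos i` is the position of the `i`-th BS, `active i` tells
whether it is active, `mark i` is the uniform variable that decides whether its link to the typical
UE is LoS, `g i` is the fading of that link if it interferes, and `h` is the fading of the serving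
link. -/
structure Network (Ω : Type*) where
  pos : ℕ → Ω → Plane
  active : ℕ → Ω → Bool
  mark : ℕ → Ω → ℝ
  g : ℕ → Ω → ℝ
  h : Ω → ℝ

namespace Network

variable {Ω : Type*} (X : Network Ω) (M : RadioModel)

/-- 3D distance of the `i`-th BS from the typical UE at the origin. -/
def linkDist (i : ℕ) (ω : Ω) : ℝ := M.dist3 ‖X.pos i ω‖

/-- Path loss of the link from the `i`-th BS; the link is LoS with probability `prLoS` of its
length. -/
def gain (i : ℕ) (ω : Ω) : ℝ :=
  if X.mark i ω ≤ M.prLoS (X.linkDist M i ω) then M.gainL (X.linkDist M i ω)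
  else M.gainNL (X.linkDist M i ω)

/-- Index of the serving BS: the one with the largest path loss gain, i.e. with the maximum average
received signal strength (the first one in case of a tie). -/
def serving (ω : Ω) : ℕ := sInf {i | ∀ j, X.gain M j ω ≤ X.gain M i ω}

/-- Aggregate interference from the active BSs other than the serving one, in `[0, ∞]`. -/
def interference (ω : Ω) : ℝ≥0∞ :=
  ∑' i, if X.active i ω = true ∧ i ≠ X.serving M ω then
    ENNReal.ofReal (M.P * X.gain M i ω * X.g i ω) else 0

/-- The SINR of the typical UE (`0` if the interference is infinite). -/
def sinr (ω : Ω) : ℝ :=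
  (ENNReal.ofReal (M.P * X.gain M (X.serving M ω) ω * X.h ω) /
    (X.interference M ω + ENNReal.ofReal M.PN)).toReal

variable [MeasurableSpace Ω]

/-- `X` is a network with BS density `l` and UE density `ρ`, on the probability space `(Ω, μ)`. -/
structure IsModel (μ : Measure Ω) (l ρ : ℝ) : Prop where
  meas_pos : ∀ i, Measurable (X.pos i)
  meas_active : ∀ i, Measurable (X.active i)
  meas_mark : ∀ i, Measurable (X.mark i)
  meas_g : ∀ i, Measurable (X.g i)
  meas_h : Measurable X.h
  /-- All BSs form a Poisson process with density `l`. -/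
  bs_hppp : IsHPPP μ X.pos (fun _ _ => true) l
  /-- The active BSs form a Poisson process with density `activeDensity`. -/
  active_hppp : IsHPPP μ X.pos X.active (M.activeDensity ρ l)
  mark_law : ∀ i, μ.map (X.mark i) = volume.restrict (Set.Icc (0 : ℝ) 1)
  mark_indep : iIndepFun X.mark μ
  /-- Rayleigh fading: power gains are exponential with mean one. -/
  g_law : ∀ i, μ.map (X.g i) = expMeasure 1
  g_indep : iIndepFun X.g μ
  h_law : μ.map X.h = expMeasure 1
  /-- The BS process (with activity), the LoS marks, the interfering fadings and the serving fading
  are independent of each other. -/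
  indep_bs : IndepFun (fun ω i => (X.pos i ω, X.active i ω))
    (fun ω => ((fun i => X.mark i ω), (fun i => X.g i ω), X.h ω)) μ
  indep_mark : IndepFun (fun ω i => X.mark i ω) (fun ω => ((fun i => X.g i ω), X.h ω)) μ
  indep_fading : IndepFun (fun ω i => X.g i ω) X.h μ

/-- Coverage probability of the typical UE. -/
def coverage (μ : Measure Ω) (γ : ℝ) : ℝ := μ.real {ω | γ < X.sinr M ω}

/-- The integrand `log₂(1 + γ) f(γ)` of the area spectral efficiency, where `f` is the probability
density function of the SINR. -/
def rateDensity (μ : Measure Ω) (γ : ℝ) : ℝ :=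
  Real.logb 2 (1 + γ) * (pdf (X.sinr M) μ volume γ).toReal

/-- Area spectral efficiency for BS density `l`, UE density `ρ` and minimum working SINR `γ₀`. -/
def ase (μ : Measure Ω) (l ρ γ₀ : ℝ) : ℝ :=
  M.activeDensity ρ l * ∫ γ in Set.Ioi γ₀, X.rateDensity M μ γ

end Network

end

/-!
Averaging over the exponential fading of the serving link turns the tail of the SINR at `γ` into the
Laplace transform, at `γ / (P ζ_o)`, of interference plus noise. If all active base stations are
counted, the probability generating functional of the marked Poisson process evaluates this Laplace
transform exactly. As `λ → ∞`, some link almost reaches the peak gain, while the bounded density of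
active base stations leaves none of them close enough to compete; hence, with probability tending to
one, the serving base station is idle, the interference is the total one, and `ζ_o` is arbitrarily
close to the peak gain, which squeezes the coverage probability.

Writing `log (1 + x)` as `∫ 1 / (1 + t)` over `0 < t < x` and exchanging integrals expresses the
area spectral efficiency through the coverage probabilities. The noise alone bounds these by a
decaying exponential of `γ`, uniformly in `λ`, so dominated convergence applies.
-/

/-- The function `exp (-x)` on `[0, ∞]` with values in `[0, ∞]`; the lower Lebesgue integral
counterpart of `RadioModel.expNeg`. -/
noncomputable def nexp (x : ℝ≥0∞) : ℝ≥0∞ := EReal.exp (-(x : EReal))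

lemma nexp_zero : nexp 0 = 1 := by simp [nexp]

lemma nexp_top : nexp ∞ = 0 := by simp [nexp]

lemma nexp_antitone : Antitone nexp := fun _ _ h =>
  EReal.exp_monotone (EReal.neg_le_neg_iff.2 (EReal.coe_ennreal_le_coe_ennreal_iff.2 h))

lemma continuous_nexp : Continuous nexp :=
  ENNReal.continuous_exp.comp (continuous_neg.comp continuous_coe_ennreal_ereal)

@[fun_prop]
lemma measurable_nexp : Measurable nexp := continuous_nexp.measurable

lemma nexp_le_one (x : ℝ≥0∞) : nexp x ≤ 1 := nexp_zero ▸ nexp_antitone zero_le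

lemma nexp_ne_top (x : ℝ≥0∞) : nexp x ≠ ∞ := ne_top_of_le_ne_top ENNReal.one_ne_top (nexp_le_one x)

lemma nexp_add (x y : ℝ≥0∞) : nexp (x + y) = nexp x * nexp y := by
  rw [nexp, EReal.coe_ennreal_add, EReal.neg_add (by simp) (by simp), sub_eq_add_neg,
    EReal.exp_add, nexp, nexp]

lemma nexp_ofReal {x : ℝ} (hx : 0 ≤ x) :
    nexp (ENNReal.ofReal x) = ENNReal.ofReal (Real.exp (-x)) := by
  rw [nexp, EReal.coe_ennreal_ofReal, max_eq_left hx, ← EReal.coe_neg, EReal.exp_coe]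

lemma nexp_eq_ofReal {x : ℝ≥0∞} (hx : x ≠ ∞) : nexp x = ENNReal.ofReal (Real.exp (-x.toReal)) := by
  rw [← nexp_ofReal ENNReal.toReal_nonneg, ENNReal.ofReal_toReal hx]

lemma nexp_sum {ι : Type*} (s : Finset ι) (a : ι → ℝ≥0∞) :
    nexp (∑ i ∈ s, a i) = ∏ i ∈ s, nexp (a i) := by
  classical
  induction s using Finset.induction_on with
  | empty => simp [nexp_zero]
  | insert i s hi ih => rw [Finset.sum_insert hi, Finset.prod_insert hi, nexp_add, ih]

lemma nexp_natCast_mul (n : ℕ) (x : ℝ≥0∞) : nexp (n * x) = nexp x ^ n := by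
  simpa using nexp_sum (Finset.range n) fun _ => x

lemma RadioModel.expNeg_eq_toReal_nexp (x : ℝ≥0∞) : expNeg x = (nexp x).toReal := by
  rw [expNeg]
  split_ifs with h
  · simp [h, nexp_top]
  · rw [nexp_eq_ofReal h, ENNReal.toReal_ofReal (Real.exp_pos _).le]

/-- The function `-log v` on `[0, 1]`, which is a right inverse of `nexp` there. -/
noncomputable def nlog (v : ℝ≥0∞) : ℝ≥0∞ := (-(ENNReal.log v)).toENNReal

lemma nexp_nlog {v : ℝ≥0∞} (hv : v ≤ 1) : nexp (nlog v) = v := by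
  have h : 0 ≤ -(ENNReal.log v) := by
    simpa [EReal.neg_nonneg] using ENNReal.logOrderIso.monotone hv
  rw [nexp, nlog, EReal.coe_toENNReal h, neg_neg, ENNReal.exp_log]

@[fun_prop]
lemma measurable_nlog : Measurable nlog := ENNReal.measurable_log.neg.ereal_toENNReal

/-- The infinite product of a sequence with values in `[0, 1]`, for which the partial products are
decreasing. -/
noncomputable def infProd (a : ℕ → ℝ≥0∞) : ℝ≥0∞ := ⨅ n, ∏ i ∈ Finset.range n, a i

lemma antitone_prod_range {a : ℕ → ℝ≥0∞} (ha : ∀ i, a i ≤ 1) :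
    Antitone fun n => ∏ i ∈ Finset.range n, a i :=
  antitone_nat_of_succ_le fun n => by
    rw [Finset.prod_range_succ]
    exact mul_le_of_le_one_right zero_le (ha n)

lemma nexp_tsum (a : ℕ → ℝ≥0∞) : nexp (∑' i, a i) = infProd fun i => nexp (a i) := by
  have h : Tendsto (fun n => nexp (∑ i ∈ Finset.range n, a i)) atTop (𝓝 (nexp (∑' i, a i))) :=
    (continuous_nexp.tendsto _).comp ENNReal.summable.hasSum.tendsto_sum_nat
  simp only [nexp_sum] at h
  exact tendsto_nhds_unique h (tendsto_atTop_iInf (antitone_prod_range fun i => nexp_le_one (a i)))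

lemma infProd_ite (p : ℕ → Prop) [DecidablePred p] [Decidable (∃ i, p i)] :
    infProd (fun i => if p i then (0 : ℝ≥0∞) else 1) = if ∃ i, p i then 0 else 1 := by
  rw [infProd]
  split_ifs with h
  · obtain ⟨i, hi⟩ := h
    exact le_antisymm (iInf_le_of_le (i + 1)
      (Finset.prod_eq_zero (Finset.self_mem_range_succ i) (by rw [if_pos hi])).le) zero_le
  · push Not at h
    simp [h]

section Independence

variable {Ω S T : Type*} [MeasurableSpace Ω] [MeasurableSpace S] [MeasurableSpace T]
  {μ : Measure Ω}

lemma lintegral_infProd [IsFiniteMeasure μ] {a : ℕ → Ω → ℝ≥0∞}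
    (ha : ∀ i, Measurable (a i)) (ha1 : ∀ i ω, a i ω ≤ 1) :
    ∫⁻ ω, infProd (fun i => a i ω) ∂μ = ⨅ n, ∫⁻ ω, ∏ i ∈ Finset.range n, a i ω ∂μ :=
  lintegral_iInf (fun n => Finset.measurable_fun_prod _ fun i _ => ha i)
    (fun _ _ h ω => antitone_prod_range (fun i => ha1 i ω) h) (by simp)

lemma lintegral_prod_of_iIndepFun {ι : Type*} {U : Ω → S} {Y : ι → Ω → T} (hU : Measurable U)
    (hY : ∀ i, Measurable (Y i)) (hYi : iIndepFun Y μ) (hUY : IndepFun U (fun ω i => Y i ω) μ)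
    {F : ι → S → T → ℝ≥0∞} (hF : ∀ i, Measurable (Function.uncurry (F i))) (s : Finset ι) :
    ∫⁻ ω, ∏ i ∈ s, F i (U ω) (Y i ω) ∂μ =
      ∫⁻ ω, ∏ i ∈ s, ∫⁻ t, F i (U ω) t ∂(μ.map (Y i)) ∂μ := by
  have := hYi.isProbabilityMeasure
  have hYm : Measurable fun ω i => Y i ω := measurable_pi_lambda _ hY
  have hG : Measurable fun p : S × (ι → T) => ∏ i ∈ s, F i p.1 (p.2 i) :=
    Finset.measurable_fun_prod _ fun i _ =>
      (hF i).comp (measurable_fst.prodMk ((measurable_pi_apply i).comp measurable_snd))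
  have hFu : ∀ i u, Measurable (F i u) := fun i u => (hF i).comp measurable_prodMk_left
  calc ∫⁻ ω, ∏ i ∈ s, F i (U ω) (Y i ω) ∂μ
      = ∫⁻ p, ∏ i ∈ s, F i p.1 (p.2 i) ∂(μ.map fun ω => (U ω, fun i => Y i ω)) :=
        (lintegral_map hG (hU.prodMk hYm)).symm
    _ = ∫⁻ u, ∫⁻ y, ∏ i ∈ s, F i u (y i) ∂(μ.map fun ω i => Y i ω) ∂(μ.map U) := by
        rw [hUY.map_prod_eq_prod_map_map hU.aemeasurable hYm.aemeasurable,
          lintegral_prod _ hG.aemeasurable]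
    _ = ∫⁻ u, ∏ i ∈ s, ∫⁻ t, F i u t ∂(μ.map (Y i)) ∂(μ.map U) := by
        refine lintegral_congr fun u => ?_
        rw [lintegral_map (f := fun y : ι → T => ∏ i ∈ s, F i u (y i))
          (hG.comp measurable_prodMk_left) hYm]
        simp only [lintegral_map (hFu _ u) (hY _)]
        exact lintegral_prod_eq_prod_lintegral_of_indepFun s (fun i ω => F i u (Y i ω))
          (hYi.comp (fun i => F i u) fun i => hFu i u) (fun i => (hFu i u).comp (hY i))
    _ = ∫⁻ ω, ∏ i ∈ s, ∫⁻ t, F i (U ω) t ∂(μ.map (Y i)) ∂μ :=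
        lintegral_map (Finset.measurable_fun_prod _ fun i _ => (hF i).lintegral_prod_right') hU

lemma lintegral_infProd_of_iIndepFun {U : Ω → S} {Y : ℕ → Ω → T} (hU : Measurable U)
    (hY : ∀ i, Measurable (Y i)) (hYi : iIndepFun Y μ) (hUY : IndepFun U (fun ω i => Y i ω) μ)
    {F : ℕ → S → T → ℝ≥0∞} (hF : ∀ i, Measurable (Function.uncurry (F i)))
    (hF1 : ∀ i u t, F i u t ≤ 1) :
    ∫⁻ ω, infProd (fun i => F i (U ω) (Y i ω)) ∂μ =
      ∫⁻ ω, infProd (fun i => ∫⁻ t, F i (U ω) t ∂(μ.map (Y i))) ∂μ := by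
  have := hYi.isProbabilityMeasure
  have := fun i => Measure.isProbabilityMeasure_map (hY i).aemeasurable (μ := μ)
  rw [lintegral_infProd (a := fun i ω => F i (U ω) (Y i ω))
      (fun i => (hF i).comp (hU.prodMk (hY i))) (fun i ω => hF1 i _ _),
    lintegral_infProd (a := fun i ω => ∫⁻ t, F i (U ω) t ∂(μ.map (Y i)))
      (fun i => (hF i).lintegral_prod_right'.comp hU)
      (fun i ω => (lintegral_mono fun t => hF1 i _ t).trans (by simp))]
  simp only [lintegral_prod_of_iIndepFun hU hY hYi hUY hF]

lemma indepFun_prodMk_left {V : Type*} [MeasurableSpace V] [IsFiniteMeasure μ]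
    {A : Ω → S} {B : Ω → T} {C : Ω → V} (hA : Measurable A) (hB : Measurable B) (hC : Measurable C)
    (hABC : IndepFun A (fun ω => (B ω, C ω)) μ) (hBC : IndepFun B C μ) :
    IndepFun (fun ω => (A ω, B ω)) C μ := by
  have hAB : IndepFun A B μ := hABC.comp (φ := id) (ψ := Prod.fst) measurable_id measurable_fst
  have hassoc := (measurePreserving_prodAssoc (μ.map A) (μ.map B) (μ.map C)).symm
  have hmap := hABC.map_prod_eq_prod_map_map hA.aemeasurable (hB.prodMk hC).aemeasurable
  rw [hBC.map_prod_eq_prod_map_map hB.aemeasurable hC.aemeasurable] at hmap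
  rw [indepFun_iff_map_prod_eq_prod_map_map (hA.prodMk hB).aemeasurable hC.aemeasurable,
    hAB.map_prod_eq_prod_map_map hA.aemeasurable hB.aemeasurable, ← hassoc.map_eq, ← hmap,
    Measure.map_map hassoc.measurable (hA.prodMk (hB.prodMk hC))]
  rfl

end Independence

section PolarCoordinates

lemma lintegral_fun_norm_addHaar {E : Type*} [NormedAddCommGroup E] [NormedSpace ℝ E]
    [FiniteDimensional ℝ E] [Nontrivial E] [MeasurableSpace E] [BorelSpace E] (ν : Measure E)
    [ν.IsAddHaarMeasure] {f : ℝ → ℝ≥0∞} (hf : Measurable f) :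
    ∫⁻ x, f ‖x‖ ∂ν = Module.finrank ℝ E * ν (Metric.ball 0 1) *
      ∫⁻ u in Set.Ioi (0 : ℝ), ENNReal.ofReal (u ^ (Module.finrank ℝ E - 1)) * f u := by
  have hf' : Measurable fun u : Set.Ioi (0 : ℝ) => f u := hf.comp measurable_subtype_coe
  calc ∫⁻ x, f ‖x‖ ∂ν
      = ∫⁻ x : ({(0)}ᶜ : Set E), f ‖x.1‖ ∂(Measure.comap Subtype.val ν) := by
        rw [lintegral_subtype_comap (measurableSet_singleton _).compl (fun x : E => f ‖x‖),
          restrict_compl_singleton]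
    _ = ∫⁻ x, f x.2 ∂(ν.toSphere.prod (Measure.volumeIoiPow (Module.finrank ℝ E - 1))) := by
        simpa using (ν.measurePreserving_homeomorphUnitSphereProd.lintegral_comp_emb
          (Homeomorph.measurableEmbedding _) fun x => f x.2)
    _ = ν.toSphere Set.univ *
          ∫⁻ u : Set.Ioi (0 : ℝ), f u ∂(Measure.volumeIoiPow (Module.finrank ℝ E - 1)) := by
        rw [lintegral_prod (fun x : Metric.sphere (0 : E) 1 × Set.Ioi (0 : ℝ) => f x.2)
          (hf'.comp measurable_snd).aemeasurable]
        simp only [lintegral_const, mul_comm]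
    _ = _ := by
        rw [Measure.toSphere_apply_univ, Measure.volumeIoiPow,
          lintegral_withDensity_eq_lintegral_mul _
            (measurable_subtype_coe.pow_const _).ennreal_ofReal hf',
          ← lintegral_subtype_comap measurableSet_Ioi]
        rfl

lemma lintegral_plane_norm {f : ℝ → ℝ≥0∞} (hf : Measurable f) :
    ∫⁻ x : Plane, f ‖x‖ = ENNReal.ofReal (2 * Real.pi) *
      ∫⁻ u in Set.Ioi (0 : ℝ), ENNReal.ofReal u * f u := by
  have hdim : Module.finrank ℝ Plane = 2 := by simp [Plane]
  rw [lintegral_fun_norm_addHaar volume hf, hdim, EuclideanSpace.volume_ball_fin_two,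
    ENNReal.ofReal_mul zero_le_two]
  simp

end PolarCoordinates

section Exponential

lemma expMeasure_absolutelyContinuous (r : ℝ) : expMeasure r ≪ volume :=
  withDensity_absolutelyContinuous _ _

lemma lintegral_nexp_expMeasure {r : ℝ} (hr : 0 < r) {a : ℝ} (ha : 0 ≤ a) :
    ∫⁻ x, nexp (ENNReal.ofReal (a * x)) ∂(expMeasure r) = ENNReal.ofReal (r / (r + a)) := by
  have hpdf : ∀ r, Measurable (exponentialPDF r) := fun r =>
    (measurable_exponentialPDFReal r).ennreal_ofReal
  have htilt : ∀ x, (exponentialPDF r * fun x => nexp (ENNReal.ofReal (a * x))) x =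
      ENNReal.ofReal (r / (r + a)) * exponentialPDF (r + a) x := by
    intro x
    simp only [Pi.mul_apply, exponentialPDF_eq]
    split_ifs with hx
    · rw [nexp_ofReal (by positivity), ← ENNReal.ofReal_mul (by positivity),
        ← ENNReal.ofReal_mul (by positivity), mul_assoc, ← Real.exp_add, ← mul_assoc,
        div_mul_cancel₀ _ (by positivity)]
      ring_nf
    · simp
  rw [show expMeasure r = volume.withDensity (exponentialPDF r) from rfl,
    lintegral_withDensity_eq_lintegral_mul _ (hpdf r) (by fun_prop), lintegral_congr htilt,
    lintegral_const_mul _ (hpdf _), lintegral_exponentialPDF_eq_one (by positivity), mul_one]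

lemma expMeasure_Ioi {r : ℝ} (hr : 0 < r) {t : ℝ} (ht : 0 ≤ t) :
    expMeasure r (Set.Ioi t) = ENNReal.ofReal (Real.exp (-(r * t))) := by
  have := isProbabilityMeasure_expMeasure hr
  have hcdf := cdf_expMeasure_eq hr t
  rw [if_pos ht, cdf_eq_real] at hcdf
  rw [← ofReal_measureReal, ← Set.compl_Iic, probReal_compl_eq_one_sub measurableSet_Iic, hcdf,
    sub_sub_cancel]

lemma expMeasure_lt_ofReal {r : ℝ} (hr : 0 < r) (K : ℝ≥0∞) :
    expMeasure r {x | K < ENNReal.ofReal x} = nexp (ENNReal.ofReal r * K) := by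
  rcases eq_or_ne K ∞ with rfl | hK
  · simp [ENNReal.mul_top, hr, nexp_top]
  · have hset : {x | K < ENNReal.ofReal x} = Set.Ioi K.toReal := by
      ext x
      simp [ENNReal.lt_ofReal_iff_toReal_lt hK]
    rw [hset, expMeasure_Ioi hr ENNReal.toReal_nonneg,
      nexp_eq_ofReal (ENNReal.mul_ne_top ENNReal.ofReal_ne_top hK), ENNReal.toReal_mul,
      ENNReal.toReal_ofReal hr.le]

end Exponential

section IndependentFactor

variable {Ω : Type*} [MeasurableSpace Ω] {μ : Measure Ω} [IsFiniteMeasure μ] {H : Ω → ℝ}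

lemma measure_lt_ofReal_of_map_eq_expMeasure {r : ℝ} (hr : 0 < r) {K : Ω → ℝ≥0∞}
    (hK : Measurable K) (hH : Measurable H) (hKH : IndepFun K H μ) (hlaw : μ.map H = expMeasure r) :
    μ {ω | K ω < ENNReal.ofReal (H ω)} = ∫⁻ ω, nexp (ENNReal.ofReal r * K ω) ∂μ := by
  have hA : MeasurableSet {p : ℝ≥0∞ × ℝ | p.1 < ENNReal.ofReal p.2} :=
    measurableSet_lt measurable_fst (by fun_prop)
  calc μ {ω | K ω < ENNReal.ofReal (H ω)}
      = ((μ.map K).prod (expMeasure r)) {p | p.1 < ENNReal.ofReal p.2} := by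
        rw [← hlaw, ← hKH.map_prod_eq_prod_map_map hK.aemeasurable hH.aemeasurable,
          Measure.map_apply (hK.prodMk hH) hA]
        rfl
    _ = ∫⁻ k, nexp (ENNReal.ofReal r * k) ∂(μ.map K) := by
        have := isProbabilityMeasure_expMeasure hr
        rw [Measure.prod_apply hA]
        exact lintegral_congr fun k => expMeasure_lt_ofReal hr k
    _ = ∫⁻ ω, nexp (ENNReal.ofReal r * K ω) ∂μ := lintegral_map (by fun_prop) hK

lemma measure_mul_mem_eq_zero {Z : Ω → ℝ} (hZ : Measurable Z) (hH : Measurable H)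
    (hZH : IndepFun Z H μ) (hac : μ.map H ≪ volume) {A : Set ℝ} (hA : volume A = 0) :
    μ {ω | Z ω * H ω ∈ A \ {0}} = 0 := by
  set B : Set ℝ := toMeasurable volume A \ {0}
  have hB : MeasurableSet B := (measurableSet_toMeasurable _ _).diff (measurableSet_singleton 0)
  have hB0 : volume B = 0 :=
    measure_mono_null Set.sdiff_subset ((measure_toMeasurable A).trans hA)
  have hC : MeasurableSet {p : ℝ × ℝ | p.1 * p.2 ∈ B} := (measurable_fst.mul measurable_snd) hB
  have hslice : ∀ z : ℝ, μ.map H (Prod.mk z ⁻¹' {p : ℝ × ℝ | p.1 * p.2 ∈ B}) = 0 := by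
    intro z
    rcases eq_or_ne z 0 with rfl | hz
    · simp [B]
    · refine hac ?_
      rw [show Prod.mk z ⁻¹' {p : ℝ × ℝ | p.1 * p.2 ∈ B} = (z * ·) ⁻¹' B from rfl,
        Real.volume_preimage_mul_left hz, hB0, mul_zero]
  refine measure_mono_null (t := {ω | Z ω * H ω ∈ B})
    (fun ω hω => ⟨subset_toMeasurable _ _ hω.1, hω.2⟩) ?_
  calc μ ((fun ω => (Z ω, H ω)) ⁻¹' {p | p.1 * p.2 ∈ B})
      = ((μ.map Z).prod (μ.map H)) {p | p.1 * p.2 ∈ B} := by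
        rw [← hZH.map_prod_eq_prod_map_map hZ.aemeasurable hH.aemeasurable,
          Measure.map_apply (hZ.prodMk hH) hC]
    _ = 0 := by
        rw [Measure.prod_apply hC]
        simp only [hslice, lintegral_zero]

end IndependentFactor

section Poisson

lemma lintegral_pow_poissonMeasure (r : NNReal) {z : ℝ≥0∞} (hz : z ≤ 1) :
    ∫⁻ k, z ^ k ∂(poissonMeasure r) = nexp (r * (1 - z)) := by
  lift z to NNReal using ne_top_of_le_ne_top ENNReal.one_ne_top hz
  have hz' : (z : ℝ) ≤ 1 := by exact_mod_cast hz
  have hterm : ∀ k : ℕ, (z : ℝ≥0∞) ^ k * poissonMeasure r {k} =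
      ENNReal.ofReal (Real.exp (-r) * ((r * z : ℝ) ^ k / k.factorial)) := by
    intro k
    rw [poissonMeasure_singleton, ← ENNReal.ofReal_coe_nnreal (p := z),
      ← ENNReal.ofReal_pow z.coe_nonneg, ← ENNReal.ofReal_mul (by positivity)]
    ring_nf
  have hsum : HasSum (fun k : ℕ => Real.exp (-r) * ((r * z : ℝ) ^ k / k.factorial))
      (Real.exp (-r) * Real.exp (r * z)) := by
    rw [Real.exp_eq_exp_ℝ]
    exact (NormedSpace.expSeries_div_hasSum_exp (r * z : ℝ)).mul_left _
  have hexponent : (r : ℝ≥0∞) * (1 - z) = ENNReal.ofReal (r * (1 - z)) := by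
    rw [ENNReal.ofReal_mul r.coe_nonneg, ENNReal.ofReal_sub _ z.coe_nonneg]
    simp
  rw [lintegral_countable', tsum_congr hterm,
    ← ENNReal.ofReal_tsum_of_nonneg (fun k => by positivity) hsum.summable, hsum.tsum_eq,
    ← Real.exp_add, hexponent, nexp_ofReal (mul_nonneg r.coe_nonneg (sub_nonneg.2 hz'))]
  ring_nf

lemma eq_map_natCast_of_singleton {ν : Measure ℕ∞} [IsProbabilityMeasure ν] {p : Measure ℕ}
    [IsProbabilityMeasure p] (h : ∀ k : ℕ, ν {(k : ℕ∞)} = p {k}) : ν = p.map Nat.cast := by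
  have hcast : Measurable (Nat.cast : ℕ → ℕ∞) := measurable_from_top
  have := Measure.isProbabilityMeasure_map (μ := p) hcast.aemeasurable
  refine (Measure.eq_of_le_of_isProbabilityMeasure (Measure.le_iff.2 fun s hs => ?_)).symm
  calc p.map Nat.cast s = ∑' k : (Nat.cast ⁻¹' s : Set ℕ), p {k.1} := by
        rw [Measure.map_apply hcast hs, ← Measure.tsum_indicator_apply_singleton _ _ .of_discrete,
          tsum_subtype (Nat.cast ⁻¹' s : Set ℕ) fun k => p {k}]
    _ = ∑' k : (Nat.cast ⁻¹' s : Set ℕ), ν {(k.1 : ℕ∞)} := by simp only [h]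
    _ = ν (⋃ k : (Nat.cast ⁻¹' s : Set ℕ), {(k.1 : ℕ∞)}) :=
        (measure_iUnion (fun i j hij => by
          simpa using fun h => hij (Subtype.ext (by exact_mod_cast h)))
          fun _ => measurableSet_singleton _).symm
    _ ≤ ν s := measure_mono (Set.iUnion_subset fun k => Set.singleton_subset_iff.2 k.2)

end Poisson

section PointProcess

variable {Ω : Type*}

/-- The counting measure of the selected points, which turns functionals of a point process into
integrals. -/
noncomputable def pointMeasure (b : ℕ → Ω → Plane) (sel : ℕ → Ω → Bool) (ω : Ω) : Measure Plane :=
  Measure.sum fun i => if sel i ω = true then Measure.dirac (b i ω) else 0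

lemma lintegral_pointMeasure (b : ℕ → Ω → Plane) (sel : ℕ → Ω → Bool) (ω : Ω) {f : Plane → ℝ≥0∞}
    (hf : Measurable f) :
    ∫⁻ x, f x ∂(pointMeasure b sel ω) = ∑' i, if sel i ω = true then f (b i ω) else 0 := by
  rw [pointMeasure, lintegral_sum_measure]
  refine tsum_congr fun i => ?_
  split_ifs
  · exact lintegral_dirac' _ hf
  · simp

lemma pointMeasure_apply (b : ℕ → Ω → Plane) (sel : ℕ → Ω → Bool) (ω : Ω) {B : Set Plane}
    (hB : MeasurableSet B) :
    pointMeasure b sel ω B = (pointCount b sel B ω : ℝ≥0∞) := by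
  rw [← lintegral_indicator_one hB, lintegral_pointMeasure b sel ω (measurable_one.indicator hB),
    pointCount, ← ENNReal.tsum_set_one, tsum_subtype _ (fun _ : ℕ => (1 : ℝ≥0∞))]
  refine tsum_congr fun i => ?_
  by_cases h1 : sel i ω = true <;> by_cases h2 : b i ω ∈ B <;> simp [h1, h2]

variable [MeasurableSpace Ω] {b : ℕ → Ω → Plane} {sel : ℕ → Ω → Bool}

lemma measurable_pointCount (hb : ∀ i, Measurable (b i)) (hs : ∀ i, Measurable (sel i))
    {B : Set Plane} (hB : MeasurableSet B) : Measurable (pointCount b sel B) := by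
  refine measurable_encard.comp (measurable_set_iff.2 fun i => ?_)
  exact measurableSet_setOfPred.1 ((hs i (measurableSet_singleton true)).inter (hb i hB))

lemma measurable_lintegral_pointMeasure (hb : ∀ i, Measurable (b i)) (hs : ∀ i, Measurable (sel i))
    {f : Plane → ℝ≥0∞} (hf : Measurable f) :
    Measurable fun ω => ∫⁻ x, f x ∂(pointMeasure b sel ω) := by
  simp only [lintegral_pointMeasure _ _ _ hf]
  exact Measurable.tsum fun i =>
    Measurable.ite (hs i (measurableSet_singleton true)) (hf.comp (hb i)) measurable_const

end PointProcess

section Approximation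

variable {α : Type*} [MeasurableSpace α]

lemma exists_simpleFunc_finMeasSupp_tendsto (ν : Measure α) [SigmaFinite ν] {f : α → ℝ≥0∞}
    (hf : Measurable f) : ∃ F : ℕ → SimpleFunc α ℝ≥0∞, (∀ n, (F n).FinMeasSupp ν) ∧
      (∀ x, Monotone fun n => F n x) ∧ ∀ x, Tendsto (fun n => F n x) atTop (𝓝 (f x)) := by
  set E : ℕ → SimpleFunc α ℝ≥0∞ := SimpleFunc.eapprox f
  have hE : ∀ n x, (E n).restrict (spanningSets ν n) x = (spanningSets ν n).indicator (E n) x :=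
    fun n => SimpleFunc.restrict_apply _ (measurableSet_spanningSets ν n)
  refine ⟨fun n => (E n).restrict (spanningSets ν n), fun n => ?_, fun x m n hmn => ?_, fun x => ?_⟩
  · refine SimpleFunc.finMeasSupp_iff_support.2 ((measure_mono ?_).trans_lt
      (measure_spanningSets_lt_top ν n))
    intro x hx
    by_contra hxn
    exact hx (by rw [hE, Set.indicator_of_notMem hxn])
  · simp only [hE]
    exact (Set.indicator_le_indicator_of_subset (monotone_spanningSets ν hmn)
      (fun _ => zero_le) x).trans
      (Set.indicator_le_indicator (SimpleFunc.monotone_eapprox f hmn x))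
  · have hlim : Tendsto (fun n => E n x) atTop (𝓝 (f x)) := by
      rw [← SimpleFunc.iSup_eapprox_apply hf x]
      exact tendsto_atTop_iSup fun m n hmn => SimpleFunc.monotone_eapprox f hmn x
    refine hlim.congr' ?_
    filter_upwards [eventually_ge_atTop (spanningSetsIndex ν x)] with n hn
    rw [hE, Set.indicator_of_mem (mem_spanningSets_of_index_le ν x hn)]

lemma tendsto_lintegral_one_sub_nexp {ν : Measure α} {F : ℕ → α → ℝ≥0∞} {f : α → ℝ≥0∞}
    (hF : ∀ n, Measurable (F n)) (hmono : ∀ x, Monotone fun n => F n x)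
    (hlim : ∀ x, Tendsto (fun n => F n x) atTop (𝓝 (f x))) :
    Tendsto (fun n => ∫⁻ x, (1 - nexp (F n x)) ∂ν) atTop (𝓝 (∫⁻ x, (1 - nexp (f x)) ∂ν)) :=
  lintegral_tendsto_of_tendsto_of_monotone
    (fun n => (measurable_const.sub (measurable_nexp.comp (hF n))).aemeasurable)
    (ae_of_all _ fun x _ _ h => tsub_le_tsub_left (nexp_antitone (hmono x h)) 1)
    (ae_of_all _ fun x => ENNReal.Tendsto.sub tendsto_const_nhds
      ((continuous_nexp.tendsto _).comp (hlim x)) (Or.inl ENNReal.one_ne_top))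

end Approximation

namespace IsHPPP

variable {Ω : Type*} [MeasurableSpace Ω] {μ : Measure Ω} {b : ℕ → Ω → Plane}
  {sel : ℕ → Ω → Bool} {dens : ℝ}

lemma isProbabilityMeasure (H : IsHPPP μ b sel dens) : IsProbabilityMeasure μ :=
  (H.indep 0 (fun _ => ∅) (fun _ => .empty) (fun j => j.elim0)).isProbabilityMeasure

lemma iIndepFun_pointCount (H : IsHPPP μ b sel dens) {ι : Type*} [Finite ι] {B : ι → Set Plane}
    (hB : ∀ j, MeasurableSet (B j)) (hdisj : Pairwise fun j k => Disjoint (B j) (B k)) :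
    iIndepFun (fun j => pointCount b sel (B j)) μ := by
  let e := Finite.equivFin ι
  have h := (H.indep _ (fun j => B (e.symm j)) (fun j => hB _)
    fun j k hjk => hdisj (e.symm.injective.ne hjk)).precomp e.injective
  simpa using h

lemma map_pointCount (H : IsHPPP μ b sel dens) (hb : ∀ i, Measurable (b i))
    (hs : ∀ i, Measurable (sel i)) {B : Set Plane} (hB : MeasurableSet B) (hvB : volume B ≠ ∞) :
    μ.map (pointCount b sel B) =
      (poissonMeasure (dens * (volume B).toReal).toNNReal).map Nat.cast := by
  have := H.isProbabilityMeasure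
  have hm := measurable_pointCount hb hs hB
  have := Measure.isProbabilityMeasure_map (μ := μ) hm.aemeasurable
  refine eq_map_natCast_of_singleton fun k => ?_
  rw [Measure.map_apply hm (measurableSet_singleton _), ← H.poisson B hB hvB k]
  rfl

lemma ae_pointCount_ne_top (H : IsHPPP μ b sel dens) (hb : ∀ i, Measurable (b i))
    (hs : ∀ i, Measurable (sel i)) {B : Set Plane} (hB : MeasurableSet B) (hvB : volume B ≠ ∞) :
    ∀ᵐ ω ∂μ, pointCount b sel B ω ≠ ⊤ := by
  refine ae_of_ae_map (p := (· ≠ ⊤)) (measurable_pointCount hb hs hB).aemeasurable ?_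
  rw [H.map_pointCount hb hs hB hvB,
    ae_map_iff (p := (· ≠ ⊤)) measurable_from_top.aemeasurable (measurableSet_singleton _).compl]
  exact ae_of_all _ fun k => ENat.natCast_ne_top k

lemma lintegral_nexp_mul_pointCount (H : IsHPPP μ b sel dens) (hb : ∀ i, Measurable (b i))
    (hs : ∀ i, Measurable (sel i)) {B : Set Plane} (hB : MeasurableSet B) (hvB : volume B ≠ ∞)
    (c : ℝ≥0∞) :
    ∫⁻ ω, nexp (c * (pointCount b sel B ω : ℝ≥0∞)) ∂μ =
      nexp (ENNReal.ofReal dens * ((1 - nexp c) * volume B)) := by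
  have hdens : (((dens * (volume B).toReal).toNNReal : NNReal) : ℝ≥0∞) =
      ENNReal.ofReal dens * volume B := by
    rw [← ENNReal.ofReal.eq_1, ENNReal.ofReal_mul' ENNReal.toReal_nonneg,
      ENNReal.ofReal_toReal hvB]
  have hf : Measurable fun n : ℕ∞ => nexp (c * (n : ℝ≥0∞)) := measurable_from_top
  rw [← lintegral_map (f := fun n : ℕ∞ => nexp (c * (n : ℝ≥0∞))) hf
      (measurable_pointCount hb hs hB),
    H.map_pointCount hb hs hB hvB, lintegral_map hf measurable_from_top]
  simp only [ENat.toENNReal_coe, mul_comm c, nexp_natCast_mul]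
  rw [lintegral_pow_poissonMeasure _ (nexp_le_one c), hdens, mul_assoc, mul_comm (volume B)]

lemma lintegral_nexp_simpleFunc (H : IsHPPP μ b sel dens) (hb : ∀ i, Measurable (b i))
    (hs : ∀ i, Measurable (sel i)) {f : SimpleFunc Plane ℝ≥0∞} (hf : f.FinMeasSupp volume) :
    ∫⁻ ω, nexp (∫⁻ x, f x ∂(pointMeasure b sel ω)) ∂μ =
      nexp (ENNReal.ofReal dens * ∫⁻ x, (1 - nexp (f x))) := by
  let N : f.range → Ω → ℕ∞ := fun c => pointCount b sel (f ⁻¹' {c.1})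
  have hind : iIndepFun N μ := H.iIndepFun_pointCount (fun c => f.measurableSet_fiber _)
    fun c c' hc => (Set.disjoint_singleton.2 (Subtype.coe_injective.ne hc)).preimage f
  have hexp : ∀ c : f.range, Measurable fun n : ℕ∞ => nexp ((c : ℝ≥0∞) * (n : ℝ≥0∞)) := fun c =>
    measurable_from_top
  calc ∫⁻ ω, nexp (∫⁻ x, f x ∂(pointMeasure b sel ω)) ∂μ
      = ∫⁻ ω, ∏ c : f.range, nexp (c * (N c ω : ℝ≥0∞)) ∂μ := by
        refine lintegral_congr fun ω => ?_
        rw [SimpleFunc.lintegral_eq_lintegral, SimpleFunc.lintegral, nexp_sum,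
          ← Finset.prod_coe_sort]
        simp only [pointMeasure_apply _ _ _ (f.measurableSet_fiber _), N]
    _ = ∏ c : f.range, ∫⁻ ω, nexp (c * (N c ω : ℝ≥0∞)) ∂μ :=
        lintegral_prod_eq_prod_lintegral_of_indepFun _ _ (hind.comp _ hexp)
          fun c => (hexp c).comp (measurable_pointCount hb hs (f.measurableSet_fiber _))
    _ = ∏ c : f.range, nexp (ENNReal.ofReal dens * ((1 - nexp c) * volume (f ⁻¹' {c.1}))) := by
        refine Finset.prod_congr rfl fun c _ => ?_
        rcases eq_or_ne (c : ℝ≥0∞) 0 with hc | hc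
        · simp [hc, nexp_zero, H.isProbabilityMeasure]
        · exact H.lintegral_nexp_mul_pointCount hb hs (f.measurableSet_fiber _)
            (SimpleFunc.finMeasSupp_iff.1 hf c hc).ne c
    _ = nexp (ENNReal.ofReal dens * ∑ c ∈ f.range, (1 - nexp c) * volume (f ⁻¹' {c})) := by
        rw [Finset.mul_sum, nexp_sum]
        exact Finset.prod_coe_sort f.range fun c =>
          nexp (ENNReal.ofReal dens * ((1 - nexp c) * volume (f ⁻¹' {c})))
    _ = nexp (ENNReal.ofReal dens * ∫⁻ x, (1 - nexp (f x))) := by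
        rw [← SimpleFunc.map_lintegral (fun c => 1 - nexp c) f, ← SimpleFunc.lintegral_eq_lintegral]
        rfl

theorem lintegral_nexp_lintegral (H : IsHPPP μ b sel dens) (hb : ∀ i, Measurable (b i))
    (hs : ∀ i, Measurable (sel i)) {f : Plane → ℝ≥0∞} (hf : Measurable f) :
    ∫⁻ ω, nexp (∫⁻ x, f x ∂(pointMeasure b sel ω)) ∂μ =
      nexp (ENNReal.ofReal dens * ∫⁻ x, (1 - nexp (f x))) := by
  have := H.isProbabilityMeasure
  obtain ⟨F, hfin, hmono, hlim⟩ := exists_simpleFunc_finMeasSupp_tendsto volume hf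
  have hleft : Tendsto (fun n => ∫⁻ ω, nexp (∫⁻ x, F n x ∂(pointMeasure b sel ω)) ∂μ) atTop
      (𝓝 (∫⁻ ω, nexp (∫⁻ x, f x ∂(pointMeasure b sel ω)) ∂μ)) :=
    tendsto_lintegral_of_dominated_convergence (fun _ => 1)
      (fun n => measurable_nexp.comp (measurable_lintegral_pointMeasure hb hs (F n).measurable))
      (fun n => ae_of_all _ fun ω => nexp_le_one _) (by simp)
      (ae_of_all _ fun ω => (continuous_nexp.tendsto _).comp <|
        lintegral_tendsto_of_tendsto_of_monotone (fun n => (F n).measurable.aemeasurable)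
          (ae_of_all _ hmono) (ae_of_all _ hlim))
  have hright : Tendsto (fun n => nexp (ENNReal.ofReal dens * ∫⁻ x, (1 - nexp (F n x)))) atTop
      (𝓝 (nexp (ENNReal.ofReal dens * ∫⁻ x, (1 - nexp (f x))))) :=
    (continuous_nexp.tendsto _).comp (ENNReal.Tendsto.const_mul
      (tendsto_lintegral_one_sub_nexp (fun n => (F n).measurable) hmono hlim)
      (Or.inr ENNReal.ofReal_ne_top))
  exact tendsto_nhds_unique hleft
    (hright.congr fun n => (H.lintegral_nexp_simpleFunc hb hs (hfin n)).symm)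

theorem lintegral_infProd (H : IsHPPP μ b sel dens) (hb : ∀ i, Measurable (b i))
    (hs : ∀ i, Measurable (sel i)) {v : Plane → ℝ≥0∞} (hv : Measurable v) (hv1 : ∀ x, v x ≤ 1) :
    ∫⁻ ω, infProd (fun i => if sel i ω = true then v (b i ω) else 1) ∂μ =
      nexp (ENNReal.ofReal dens * ∫⁻ x, (1 - v x)) := by
  have hlog : Measurable fun x => nlog (v x) := measurable_nlog.comp hv
  calc ∫⁻ ω, infProd (fun i => if sel i ω = true then v (b i ω) else 1) ∂μ
      = ∫⁻ ω, nexp (∫⁻ x, nlog (v x) ∂(pointMeasure b sel ω)) ∂μ := by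
        simp only [lintegral_pointMeasure _ _ _ hlog, nexp_tsum, apply_ite nexp, nexp_zero,
          nexp_nlog (hv1 _)]
    _ = nexp (ENNReal.ofReal dens * ∫⁻ x, (1 - v x)) := by
        simp only [H.lintegral_nexp_lintegral hb hs hlog, nexp_nlog (hv1 _)]

section Marked

variable {T : Type*} [MeasurableSpace T] {Y : ℕ → Ω → T} {ν : Measure T}

theorem lintegral_infProd_marked (H : IsHPPP μ b sel dens) (hb : ∀ i, Measurable (b i))
    (hs : ∀ i, Measurable (sel i)) (hY : ∀ i, Measurable (Y i)) (hYi : iIndepFun Y μ)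
    (hbY : IndepFun (fun ω i => (b i ω, sel i ω)) (fun ω i => Y i ω) μ)
    (hlaw : ∀ i, μ.map (Y i) = ν) {v : Plane → T → ℝ≥0∞} (hv : Measurable (Function.uncurry v))
    (hv1 : ∀ x t, v x t ≤ 1) :
    ∫⁻ ω, infProd (fun i => if sel i ω = true then v (b i ω) (Y i ω) else 1) ∂μ =
      nexp (ENNReal.ofReal dens * ∫⁻ x, (1 - ∫⁻ t, v x t ∂ν)) := by
  have := H.isProbabilityMeasure
  have : IsProbabilityMeasure ν := hlaw 0 ▸ Measure.isProbabilityMeasure_map (hY 0).aemeasurable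
  have hF : ∀ i : ℕ, Measurable (Function.uncurry fun (u : ℕ → Plane × Bool) (t : T) =>
      if (u i).2 = true then v (u i).1 t else 1) := fun i =>
    Measurable.ite
      ((measurable_snd.comp ((measurable_pi_apply i).comp measurable_fst))
        (measurableSet_singleton true))
      (hv.comp (((measurable_pi_apply i).comp measurable_fst).fst.prodMk measurable_snd))
      measurable_const
  have haverage : ∀ ω i, ∫⁻ t, (if sel i ω = true then v (b i ω) t else 1) ∂ν =
      if sel i ω = true then ∫⁻ t, v (b i ω) t ∂ν else 1 := fun ω i => by
    split_ifs <;> simp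
  rw [lintegral_infProd_of_iIndepFun (U := fun ω i => (b i ω, sel i ω))
    (measurable_pi_lambda _ fun i => (hb i).prodMk (hs i)) hY hYi hbY hF fun i u t => by
      split_ifs
      exacts [hv1 _ _, le_rfl]]
  simp only [hlaw, haverage]
  exact H.lintegral_infProd hb hs hv.lintegral_prod_right'
    fun x => (lintegral_mono fun t => hv1 x t).trans (by simp)

lemma measure_void_marked (H : IsHPPP μ b sel dens) (hb : ∀ i, Measurable (b i))
    (hs : ∀ i, Measurable (sel i)) (hY : ∀ i, Measurable (Y i)) (hYi : iIndepFun Y μ)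
    (hbY : IndepFun (fun ω i => (b i ω, sel i ω)) (fun ω i => Y i ω) μ)
    (hlaw : ∀ i, μ.map (Y i) = ν) {A : Set (Plane × T)} (hA : MeasurableSet A) :
    μ {ω | ∀ i, sel i ω = true → (b i ω, Y i ω) ∉ A} =
      nexp (ENNReal.ofReal dens * (volume.prod ν) A) := by
  classical
  have := H.isProbabilityMeasure
  have : IsProbabilityMeasure ν := hlaw 0 ▸ Measure.isProbabilityMeasure_map (hY 0).aemeasurable
  have hvoid : MeasurableSet {ω | ∀ i, sel i ω = true → (b i ω, Y i ω) ∉ A} := by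
    simp only [Set.ofPred_forall]
    exact .iInter fun i => (hs i (measurableSet_singleton true)).imp
      (((hb i).prodMk (hY i)) hA).compl
  have hpgfl := H.lintegral_infProd_marked hb hs hY hYi hbY hlaw
    (v := fun x t => Aᶜ.indicator 1 (x, t)) (measurable_one.indicator hA.compl)
    (fun x t => Set.indicator_le_self' (by simp) _)
  have hprod : ∀ ω, {ω | ∀ i, sel i ω = true → (b i ω, Y i ω) ∉ A}.indicator 1 ω =
      infProd fun i => if sel i ω = true then Aᶜ.indicator 1 (b i ω, Y i ω) else 1 := by
    intro ω
    have hfactor : ∀ i, (if sel i ω = true then Aᶜ.indicator 1 (b i ω, Y i ω) else 1 : ℝ≥0∞) =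
        if sel i ω = true ∧ (b i ω, Y i ω) ∈ A then 0 else 1 := fun i => by
      simp only [Set.indicator_apply, Set.mem_compl_iff, Pi.one_apply]
      split_ifs <;> simp_all
    rw [funext hfactor, infProd_ite, Set.indicator_apply]
    simp only [Set.mem_ofPred_eq, Pi.one_apply]
    split_ifs <;> grind
  have hslice : ∀ x, 1 - ∫⁻ t, Aᶜ.indicator 1 (x, t) ∂ν = ν (Prod.mk x ⁻¹' A) := fun x => by
    have hAx : MeasurableSet (Prod.mk x ⁻¹' A) := measurable_prodMk_left hA
    rw [show (fun t => Aᶜ.indicator (1 : Plane × T → ℝ≥0∞) (x, t)) =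
        (Prod.mk x ⁻¹' A)ᶜ.indicator 1 from rfl, lintegral_indicator_one hAx.compl,
      prob_compl_eq_one_sub hAx, ENNReal.sub_sub_cancel ENNReal.one_ne_top prob_le_one]
  rw [← lintegral_indicator_one hvoid, lintegral_congr hprod, hpgfl, Measure.prod_apply hA]
  simp only [hslice]

end Marked

lemma measure_void (H : IsHPPP μ b sel dens) {B : Set Plane} (hB : MeasurableSet B)
    (hvB : volume B ≠ ∞) :
    μ {ω | ∀ i, sel i ω = true → b i ω ∉ B} = nexp (ENNReal.ofReal dens * volume B) := by
  have hcount : {ω | ∀ i, sel i ω = true → b i ω ∉ B} = {ω | pointCount b sel B ω = (0 : ℕ)} := by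
    ext ω
    simp [pointCount, Set.eq_empty_iff_forall_notMem]
  rw [hcount, H.poisson B hB hvB 0, poissonMeasure_singleton, nexp_eq_ofReal
    (ENNReal.mul_ne_top ENNReal.ofReal_ne_top hvB), ENNReal.toReal_mul, ENNReal.toReal_ofReal']
  simp [max_mul_of_nonneg]

end IsHPPP

namespace RadioModel

section Distance

variable (M : RadioModel)

lemma continuous_dist3 : Continuous M.dist3 := by
  unfold dist3
  fun_prop

@[fun_prop]
lemma measurable_dist3 : Measurable M.dist3 := M.continuous_dist3.measurable

lemma dist3_zero (hL : 0 ≤ M.L) : M.dist3 0 = M.L := by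
  simp [dist3, Real.sqrt_sq hL]

lemma le_dist3 (r : ℝ) : M.L ≤ M.dist3 r :=
  Real.le_sqrt_of_sq_le (by nlinarith [sq_nonneg r])

lemma lt_dist3 {r : ℝ} (hr : r ≠ 0) : M.L < M.dist3 r :=
  Real.lt_sqrt_of_sq_lt (by have := sq_pos_of_ne_zero hr; linarith)

lemma le_dist3_self (r : ℝ) : r ≤ M.dist3 r :=
  Real.le_sqrt_of_sq_le (by nlinarith [sq_nonneg M.L])

end Distance

section PowerLaw

variable (M : RadioModel)

lemma monotone_piece : Monotone M.piece := fun _ _ hab =>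
  Fin.mk_le_mk.2 (Finset.card_le_card fun _ hi => by
    simp only [Finset.mem_filter, Finset.mem_univ, true_and] at hi ⊢
    exact hi.trans_le hab)

lemma measurable_piece : Measurable M.piece :=
  measurable_to_countable' fun _ =>
    (Set.ordConnected_singleton.preimage_mono M.monotone_piece).measurableSet

lemma measurable_piecewise {f : Fin (M.m + 1) → ℝ → ℝ} (hf : ∀ n, Measurable (f n)) :
    Measurable fun w => f (M.piece w) w :=
  (measurable_from_prod_countable_right (f := fun p : Fin (M.m + 1) × ℝ => f p.1 p.2) hf).comp
    (M.measurable_piece.prodMk measurable_id)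

lemma exists_lt_piece_eq {a w : ℝ} (hw : a < w) : ∃ v, a < v ∧ v < w ∧ M.piece v = M.piece w := by
  have hbreak : ∀ᶠ v in 𝓝[<] w, ∀ i, M.d i < w → M.d i < v := by
    refine eventually_all.2 fun i => ?_
    by_cases hi : M.d i < w
    · filter_upwards [Ioo_mem_nhdsLT hi] with v hv _ using hv.1
    · exact Eventually.of_forall fun v h => absurd h hi
  obtain ⟨v, hv, hav, hvw⟩ := (hbreak.and (Ioo_mem_nhdsLT hw)).exists
  refine ⟨v, hav, hvw, (M.monotone_piece hvw.le).antisymm ?_⟩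
  refine Fin.mk_le_mk.2 (Finset.card_le_card fun i hi => ?_)
  simp only [Finset.mem_filter, Finset.mem_univ, true_and] at hi ⊢
  exact hv i hi

/-- The piecewise power law with coefficients `A` and decay exponents `α`: the common form of
`gainL` and `gainNL`. -/
noncomputable def powerLaw (A α : Fin (M.m + 1) → ℝ) (w : ℝ) : ℝ :=
  A (M.piece w) * w ^ (-α (M.piece w))

variable {A α : Fin (M.m + 1) → ℝ}

lemma measurable_powerLaw : Measurable (M.powerLaw A α) :=
  M.measurable_piecewise (f := fun n w => A n * w ^ (-α n)) fun _ => by fun_prop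

lemma powerLaw_pos (hA : ∀ n, 0 < A n) {w : ℝ} (hw : 0 < w) : 0 < M.powerLaw A α w :=
  mul_pos (hA _) (Real.rpow_pos_of_pos hw _)

lemma powerLaw_lt (hA : ∀ n, 0 < A n) (hα : ∀ n, 0 < α n) {a c : ℝ} (ha : 0 ≤ a)
    (hc : ∀ v, a ≤ v → M.powerLaw A α v ≤ c) {w : ℝ} (hw : a < w) : M.powerLaw A α w < c := by
  obtain ⟨v, hav, hvw, hpiece⟩ := M.exists_lt_piece_eq hw
  refine lt_of_lt_of_le ?_ (hc v hav.le)
  rw [powerLaw, powerLaw, hpiece]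
  exact mul_lt_mul_of_pos_left
    (Real.rpow_lt_rpow_of_neg (ha.trans_lt hav) hvw (neg_neg_of_pos (hα _))) (hA _)

lemma tendsto_powerLaw_atTop (hA : ∀ n, 0 < A n) (hα : ∀ n, 0 < α n) :
    Tendsto (M.powerLaw A α) atTop (𝓝 0) := by
  have hsum : Tendsto (fun w : ℝ => ∑ n, A n * w ^ (-α n)) atTop (𝓝 0) := by
    simpa using tendsto_finsetSum Finset.univ fun n _ =>
      (tendsto_rpow_neg_atTop (hα n)).const_mul (A n)
  refine squeeze_zero' ?_ ?_ hsum
  · filter_upwards [eventually_gt_atTop 0] with w hw using (M.powerLaw_pos hA hw).le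
  · filter_upwards [eventually_ge_atTop 0] with w hw
    exact Finset.single_le_sum (f := fun n => A n * w ^ (-α n))
      (fun n _ => mul_nonneg (hA n).le (Real.rpow_nonneg hw _)) (Finset.mem_univ _)

@[fun_prop]
lemma measurable_gainL : Measurable M.gainL := M.measurable_powerLaw

@[fun_prop]
lemma measurable_gainNL : Measurable M.gainNL := M.measurable_powerLaw

end PowerLaw

variable {M : RadioModel}

/-- The gain of a link to a BS at `x` whose line-of-sight mark is `u`. -/
noncomputable def linkGain (M : RadioModel) (x : Plane) (u : ℝ) : ℝ :=
  if u ≤ M.prLoS (M.dist3 ‖x‖) then M.gainL (M.dist3 ‖x‖) else M.gainNL (M.dist3 ‖x‖)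

/-- The positions and line-of-sight marks of the links of gain at least `t`. -/
def strongLinks (M : RadioModel) (t : ℝ) : Set (Plane × ℝ) := {z | t ≤ M.linkGain z.1 z.2}

/-- The positions at which a link can reach the gain `t`, for one of the two link types. -/
def strongSet (M : RadioModel) (t : ℝ) : Set Plane :=
  {x | t ≤ max (M.gainL (M.dist3 ‖x‖)) (M.gainNL (M.dist3 ‖x‖))}

lemma mem_strongSet_of_le_linkGain {t : ℝ} {x : Plane} {u : ℝ} (h : t ≤ M.linkGain x u) :
    x ∈ M.strongSet t := by
  refine h.trans ?_
  unfold linkGain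
  split_ifs
  exacts [le_max_left _ _, le_max_right _ _]

lemma measurableSet_strongSet (M : RadioModel) (t : ℝ) : MeasurableSet (M.strongSet t) :=
  measurableSet_le measurable_const
    (((by fun_prop : Measurable fun x : Plane => M.gainL (M.dist3 ‖x‖))).max (by fun_prop))

namespace Admissible

lemma gainL_pos (hM : M.Admissible) {w : ℝ} (hw : 0 < w) : 0 < M.gainL w :=
  M.powerLaw_pos hM.AL_pos hw

lemma gainNL_pos (hM : M.Admissible) {w : ℝ} (hw : 0 < w) : 0 < M.gainNL w :=
  M.powerLaw_pos hM.ANL_pos hw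

lemma gainL_lt (hM : M.Admissible) (hL : 0 ≤ M.L) {w : ℝ} (hw : M.L < w) :
    M.gainL w < M.peakGain :=
  M.powerLaw_lt hM.AL_pos hM.αL_pos hL hM.gainL_le hw

lemma gainNL_lt (hM : M.Admissible) (hL : 0 ≤ M.L) {w : ℝ} (hw : M.L < w) :
    M.gainNL w < M.peakGain :=
  M.powerLaw_lt hM.ANL_pos hM.αNL_pos hL hM.gainNL_le hw

lemma peakGain_pos (hM : M.Admissible) (hL : 0 < M.L) : 0 < M.peakGain :=
  mul_pos (hM.AL_pos _) (Real.rpow_pos_of_pos hL _)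

/-- `M.PrL n` itself is unconstrained outside its piece, so measurability holds only on the
distances `M.dist3 r`. -/
lemma measurable_prLoS_dist3 (hM : M.Admissible) : Measurable fun r => M.prLoS (M.dist3 r) := by
  have hext : ∀ n, ∃ g : ℝ → ℝ, Antitone g ∧
      Set.EqOn (M.PrL n) g {w | M.L ≤ w ∧ M.piece w = n} := by
    refine fun n => (hM.PrL_anti n).exists_antitone_extension ⟨0, ?_⟩ ⟨1, ?_⟩
    · rintro _ ⟨w, ⟨hw, rfl⟩, rfl⟩
      exact (hM.prLoS_mem w hw).1
    · rintro _ ⟨w, ⟨hw, rfl⟩, rfl⟩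
      exact (hM.prLoS_mem w hw).2
  choose g hg hgeq using hext
  have heq : (fun r => M.prLoS (M.dist3 r)) = fun r => g (M.piece (M.dist3 r)) (M.dist3 r) :=
    funext fun r => hgeq _ ⟨M.le_dist3 r, rfl⟩
  rw [heq]
  exact (M.measurable_piecewise fun n => (hg n).measurable).comp M.measurable_dist3

lemma measurable_linkGain (hM : M.Admissible) : Measurable (Function.uncurry M.linkGain) :=
  Measurable.ite
    (measurableSet_le measurable_snd
      (hM.measurable_prLoS_dist3.comp (measurable_norm.comp measurable_fst)))
    (by fun_prop) (by fun_prop)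

lemma measurableSet_strongLinks (hM : M.Admissible) (t : ℝ) : MeasurableSet (M.strongLinks t) :=
  measurableSet_le measurable_const hM.measurable_linkGain

lemma linkGain_pos (hM : M.Admissible) (hL : 0 < M.L) (x : Plane) (u : ℝ) :
    0 < M.linkGain x u := by
  have h := hL.trans_le (M.le_dist3 ‖x‖)
  unfold linkGain
  split_ifs
  exacts [hM.gainL_pos h, hM.gainNL_pos h]

lemma linkGain_le (hM : M.Admissible) (x : Plane) (u : ℝ) : M.linkGain x u ≤ M.peakGain := by
  unfold linkGain
  split_ifs
  exacts [hM.gainL_le _ (M.le_dist3 _), hM.gainNL_le _ (M.le_dist3 _)]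

lemma volume_strongSet_ne_top (hM : M.Admissible) {t : ℝ} (ht : 0 < t) :
    volume (M.strongSet t) ≠ ∞ := by
  have hlim : Tendsto (fun w => max (M.gainL w) (M.gainNL w)) atTop (𝓝 0) := by
    rw [← max_self (0 : ℝ)]
    exact (M.tendsto_powerLaw_atTop hM.AL_pos hM.αL_pos).max
      (M.tendsto_powerLaw_atTop hM.ANL_pos hM.αNL_pos)
  obtain ⟨R, hR⟩ := eventually_atTop.1 (hlim.eventually_lt_const ht)
  refine ((measure_mono fun x hx => ?_).trans_lt
    (measure_ball_lt_top (μ := volume) (x := (0 : Plane)) (r := R))).ne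
  rw [mem_ball_zero_iff]
  by_contra! hxR
  exact (hR _ (hxR.trans (M.le_dist3_self _))).not_ge hx

lemma tendsto_volume_strongSet (hM : M.Admissible) (hL : 0 < M.L) :
    Tendsto (fun t => volume (M.strongSet t)) (𝓝[<] M.peakGain) (𝓝 0) := by
  have hpeak := hM.peakGain_pos hL
  rw [← measure_empty (μ := (volume : Measure Plane))]
  refine tendsto_measure_of_ae_tendsto_indicator _ .empty (fun t => M.measurableSet_strongSet t)
    (M.measurableSet_strongSet (M.peakGain / 2)) (hM.volume_strongSet_ne_top (half_pos hpeak)) ?_ ?_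
  · filter_upwards [Ioo_mem_nhdsLT (half_lt_self hpeak)] with t ht x hx using ht.1.le.trans hx
  · filter_upwards [compl_mem_ae_iff.2 (measure_singleton (0 : Plane))] with x hx
    have hd := M.lt_dist3 (norm_ne_zero_iff.2 hx)
    filter_upwards [Ioo_mem_nhdsLT (max_lt (hM.gainL_lt hL.le hd) (hM.gainNL_lt hL.le hd))]
      with t ht
    exact iff_of_false ht.1.not_ge (Set.notMem_empty x)

lemma prod_strongLinks_pos (hM : M.Admissible) (hL : 0 < M.L) {t : ℝ} (ht : t < M.peakGain) :
    0 < (volume.prod (volume.restrict (Set.Icc (0 : ℝ) 1))) (M.strongLinks t) := by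
  obtain ⟨w, hw, hw0, hwp⟩ := hM.PrL_pos
  set p := M.PrL 0 w
  have hp1 : p ≤ 1 := by
    simpa [prLoS, hw0] using (hM.prLoS_mem w hw.le).2
  have hdist : Tendsto (fun x : Plane => M.dist3 ‖x‖) (𝓝 0) (𝓝 M.L) := by
    have h := (M.continuous_dist3.comp (continuous_norm (E := Plane))).tendsto 0
    rwa [Function.comp_apply, norm_zero, M.dist3_zero hL.le] at h
  have hpow : Tendsto (fun x : Plane => M.AL 0 * M.dist3 ‖x‖ ^ (-M.αL 0)) (𝓝 0)
      (𝓝 M.peakGain) := (hdist.rpow_const (Or.inl hL.ne')).const_mul _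
  obtain ⟨r, hr, hnear⟩ := Metric.eventually_nhds_iff_ball.1
    ((hdist.eventually_lt_const hw).and (hpow.eventually_const_le ht))
  have hsub : Metric.ball 0 r ×ˢ Set.Icc 0 p ⊆ M.strongLinks t := by
    rintro ⟨x, u⟩ ⟨hx, hu⟩
    obtain ⟨hxw, hxt⟩ := hnear x hx
    have hpiece : M.piece (M.dist3 ‖x‖) = 0 :=
      ((M.monotone_piece hxw.le).trans hw0.le).antisymm (Fin.zero_le _)
    have hup : u ≤ M.prLoS (M.dist3 ‖x‖) := by
      rw [prLoS, hpiece]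
      exact hu.2.trans (hM.PrL_anti 0 ⟨M.le_dist3 _, hpiece⟩ ⟨hw.le, hw0⟩ hxw.le)
    change t ≤ M.linkGain x u
    rwa [linkGain, if_pos hup, gainL, hpiece]
  refine lt_of_lt_of_le ?_ (measure_mono hsub)
  rw [Measure.prod_prod, Measure.restrict_apply measurableSet_Icc,
    Set.inter_eq_left.2 (Set.Icc_subset_Icc_right hp1), Real.volume_Icc, sub_zero]
  exact ENNReal.mul_pos (Metric.measure_ball_pos _ _ hr).ne' (ENNReal.ofReal_pos.2 hwp).ne'

lemma tendsto_activeDensity (hM : M.Admissible) (ρ : ℝ) :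
    Tendsto (fun l => M.activeDensity ρ l) atTop (𝓝 ρ) := by
  have hq := hM.q_pos
  have hderiv : HasDerivAt (fun t : ℝ => -(1 + ρ / M.q * t) ^ (-M.q)) ρ 0 := by
    have hlin : HasDerivAt (fun t : ℝ => 1 + ρ / M.q * t) (ρ / M.q) 0 := by
      simpa using ((hasDerivAt_id (0 : ℝ)).const_mul (ρ / M.q)).const_add 1
    refine ((hlin.rpow_const (p := -M.q) (Or.inl (by simp))).fun_neg).congr_deriv ?_
    simp
    field_simp
  have hslope := hderiv.tendsto_slope_zero_right.comp tendsto_inv_atTop_nhdsGT_zero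
  have hbase : Tendsto (fun l : ℝ => 1 + ρ / M.q * l⁻¹) atTop (𝓝 1) := by
    simpa using (tendsto_inv_atTop_zero.const_mul (ρ / M.q)).const_add 1
  refine hslope.congr' ?_
  filter_upwards [hbase.eventually_const_lt one_pos] with l hl
  simp only [Function.comp_apply, inv_inv, zero_add, smul_eq_mul, mul_zero, add_zero,
    Real.one_rpow, activeDensity]
  rw [Real.rpow_neg hl.le, one_div, show ρ / M.q * l⁻¹ = ρ / (M.q * l) by field_simp]
  ring

end Admissible

end RadioModel

lemma measurable_sInf_nat {Ω : Type*} [MeasurableSpace Ω] {s : Ω → Set ℕ}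
    (hs : ∀ k, MeasurableSet {ω | k ∈ s ω}) : Measurable fun ω => sInf (s ω) := by
  classical
  have hex : ∀ ω, ∃ k, k ∈ s ω ∨ ¬∃ j, j ∈ s ω := fun ω => by
    by_cases h : ∃ j, j ∈ s ω
    · exact h.imp fun _ => Or.inl
    · exact ⟨0, Or.inr h⟩
  have hempty : MeasurableSet {ω | ¬∃ j, j ∈ s ω} := by
    simp only [not_exists, Set.ofPred_forall]
    exact .iInter fun j => (hs j).compl
  have hfind : (fun ω => sInf (s ω)) = fun ω => Nat.find (hex ω) := funext fun ω => by
    rcases (s ω).eq_empty_or_nonempty with h | h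
    · have hzero : Nat.find (hex ω) = 0 := (Nat.find_eq_zero _).2 (Or.inr (by simp [h]))
      rw [hzero, h, Nat.sInf_empty]
    · rw [Nat.sInf_def h]
      exact Nat.find_congr' fun {n} => (or_iff_left (not_not.2 h)).symm
  rw [hfind]
  exact measurable_find hex fun k => (hs k).union hempty

namespace RadioModel

/-- The rate at which the noise alone makes the tail of the SINR decay. -/
noncomputable def noiseRate (M : RadioModel) : ℝ := M.PN / (M.P * M.peakGain)

end RadioModel

namespace Network

section Load

variable {Ω : Type*} (X : Network Ω) (M : RadioModel)

lemma gain_eq_linkGain (i : ℕ) (ω : Ω) : X.gain M i ω = M.linkGain (X.pos i ω) (X.mark i ω) := rfl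

/-- Interference plus noise, divided by the mean received power of the serving link: the SINR is
the ratio of the serving fading to this quantity. -/
noncomputable def load (ω : Ω) : ℝ≥0∞ :=
  (X.interference M ω + ENNReal.ofReal M.PN) / ENNReal.ofReal (M.P * X.gain M (X.serving M ω) ω)

variable {X M}

lemma gain_pos (hM : M.Admissible) (hL : 0 < M.L) (i : ℕ) (ω : Ω) : 0 < X.gain M i ω :=
  hM.linkGain_pos hL _ _

lemma gain_le (hM : M.Admissible) (i : ℕ) (ω : Ω) : X.gain M i ω ≤ M.peakGain :=
  hM.linkGain_le _ _

lemma load_ne_zero (hM : M.Admissible) (ω : Ω) : X.load M ω ≠ 0 :=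
  (ENNReal.div_pos ((ENNReal.ofReal_pos.2 hM.PN_pos).trans_le le_add_self).ne'
    ENNReal.ofReal_ne_top).ne'

lemma sinr_eq_div_load (hM : M.Admissible) (hL : 0 < M.L) (ω : Ω) :
    X.sinr M ω = (ENNReal.ofReal (X.h ω) / X.load M ω).toReal := by
  have h : 0 < M.P * X.gain M (X.serving M ω) ω := mul_pos hM.P_pos (gain_pos hM hL _ _)
  rw [sinr, load, ENNReal.ofReal_mul h.le, ENNReal.div_eq_inv_mul, ENNReal.div_eq_inv_mul,
    ENNReal.inv_div (Or.inl ENNReal.ofReal_ne_top) (Or.inl (ENNReal.ofReal_pos.2 h).ne'),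
    ENNReal.div_eq_inv_mul, mul_assoc]

lemma lt_sinr_iff (hM : M.Admissible) (hL : 0 < M.L) {γ : ℝ} (hγ : 0 < γ) (ω : Ω) :
    γ < X.sinr M ω ↔ ENNReal.ofReal γ * X.load M ω < ENNReal.ofReal (X.h ω) := by
  have hload := load_ne_zero (X := X) hM ω
  rw [sinr_eq_div_load hM hL]
  rcases eq_or_ne (X.load M ω) ∞ with h | h
  · rw [h, ENNReal.mul_top (ENNReal.ofReal_pos.2 hγ).ne']
    simp [hγ.le]
  · rw [← ENNReal.ofReal_lt_iff_lt_toReal hγ.le (ENNReal.div_ne_top ENNReal.ofReal_ne_top hload),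
      ENNReal.lt_div_iff_mul_lt (Or.inl hload) (Or.inl h)]

lemma sinr_eq_mul_of_pos (hM : M.Admissible) (hL : 0 < M.L) {ω : Ω} (hω : 0 < X.sinr M ω) :
    X.sinr M ω = (X.load M ω)⁻¹.toReal * X.h ω := by
  have hmul : X.sinr M ω = (X.load M ω)⁻¹.toReal * (ENNReal.ofReal (X.h ω)).toReal := by
    rw [sinr_eq_div_load hM hL, ENNReal.div_eq_inv_mul, ENNReal.toReal_mul]
  have hh : 0 ≤ X.h ω := le_of_not_gt fun hneg => by
    rw [hmul, ENNReal.ofReal_of_nonpos hneg.le] at hω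
    simp at hω
  rw [hmul, ENNReal.toReal_ofReal hh]

lemma ofReal_noiseRate_le_load (hM : M.Admissible) (hL : 0 < M.L) (ω : Ω) :
    ENNReal.ofReal M.noiseRate ≤ X.load M ω := by
  rw [RadioModel.noiseRate, ENNReal.ofReal_div_of_pos (mul_pos hM.P_pos (hM.peakGain_pos hL))]
  exact ENNReal.div_le_div le_add_self (ENNReal.ofReal_le_ofReal
    (mul_le_mul_of_nonneg_left (gain_le hM _ _) hM.P_pos.le))

end Load

section Measurability

variable {Ω : Type*} {M : RadioModel}

/-- All components of a network except the fading of the serving link are measurable. This is used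
both for the ambient σ-algebra and for the one generated by these components. -/
structure IsMeasurable [MeasurableSpace Ω] (X : Network Ω) : Prop where
  pos : ∀ i, Measurable (X.pos i)
  active : ∀ i, Measurable (X.active i)
  mark : ∀ i, Measurable (X.mark i)
  g : ∀ i, Measurable (X.g i)

namespace IsMeasurable

variable [MeasurableSpace Ω] {X : Network Ω}

lemma gain (hX : X.IsMeasurable) (hM : M.Admissible) (i : ℕ) : Measurable (X.gain M i) :=
  hM.measurable_linkGain.comp ((hX.pos i).prodMk (hX.mark i))

lemma serving (hX : X.IsMeasurable) (hM : M.Admissible) : Measurable (X.serving M) :=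
  measurable_sInf_nat fun i => by
    change MeasurableSet {ω | ∀ j, X.gain M j ω ≤ X.gain M i ω}
    simp only [Set.ofPred_forall]
    exact .iInter fun j => measurableSet_le (hX.gain hM j) (hX.gain hM i)

lemma gain_serving (hX : X.IsMeasurable) (hM : M.Admissible) :
    Measurable fun ω => X.gain M (X.serving M ω) ω :=
  (measurable_from_prod_countable_right (f := fun p : ℕ × Ω => X.gain M p.1 p.2)
    fun i => hX.gain hM i).comp ((hX.serving hM).prodMk measurable_id)

lemma interference (hX : X.IsMeasurable) (hM : M.Admissible) : Measurable (X.interference M) :=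
  Measurable.tsum fun i => Measurable.ite
    ((hX.active i (measurableSet_singleton true)).inter
      (measurableSet_eq_fun measurable_const (hX.serving hM)).compl)
    (((hX.gain hM i).const_mul _).mul (hX.g i)).ennreal_ofReal measurable_const

lemma load (hX : X.IsMeasurable) (hM : M.Admissible) : Measurable (X.load M) :=
  ((hX.interference hM).add_const _).div (((hX.gain_serving hM).const_mul _).ennreal_ofReal)

lemma sinr (hX : X.IsMeasurable) (hM : M.Admissible) (hh : Measurable X.h) :
    Measurable (X.sinr M) :=
  ((((hX.gain_serving hM).const_mul _).mul hh).ennreal_ofReal.div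
    ((hX.interference hM).add_const _)).ennreal_toReal

end IsMeasurable

/-- All components of a network except the fading of the serving link. -/
def environment (X : Network Ω) (ω : Ω) : ((ℕ → Plane × Bool) × (ℕ → ℝ)) × (ℕ → ℝ) :=
  ((fun i => (X.pos i ω, X.active i ω), fun i => X.mark i ω), fun i => X.g i ω)

lemma isMeasurable_comap_environment (X : Network Ω) :
    @IsMeasurable Ω (MeasurableSpace.comap X.environment inferInstance) X := by
  let m : MeasurableSpace Ω := MeasurableSpace.comap X.environment inferInstance
  have h : Measurable X.environment := comap_measurable _
  exact ⟨fun i => ((measurable_pi_apply i).comp h.fst.fst).fst,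
    fun i => ((measurable_pi_apply i).comp h.fst.fst).snd,
    fun i => (measurable_pi_apply i).comp h.fst.snd, fun i => (measurable_pi_apply i).comp h.snd⟩

end Measurability

namespace IsModel

variable {Ω : Type*} [MeasurableSpace Ω] {X : Network Ω} {M : RadioModel} {μ : Measure Ω} {l ρ : ℝ}

lemma isMeasurable (hX : X.IsModel M μ l ρ) : X.IsMeasurable :=
  ⟨hX.meas_pos, hX.meas_active, hX.meas_mark, hX.meas_g⟩

lemma measurable_bs (hX : X.IsModel M μ l ρ) : Measurable fun ω i => (X.pos i ω, X.active i ω) :=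
  measurable_pi_lambda _ fun i => (hX.meas_pos i).prodMk (hX.meas_active i)

lemma measurable_bs_mark (hX : X.IsModel M μ l ρ) :
    Measurable fun ω => ((fun i => (X.pos i ω, X.active i ω)), fun i => X.mark i ω) :=
  hX.measurable_bs.prodMk (measurable_pi_lambda _ hX.meas_mark)

lemma indep_bs_mark (hX : X.IsModel M μ l ρ) :
    IndepFun (fun ω i => (X.pos i ω, X.active i ω)) (fun ω i => X.mark i ω) μ :=
  hX.indep_bs.comp (φ := id) (ψ := Prod.fst) measurable_id measurable_fst

lemma indep_bs_mark_fading (hX : X.IsModel M μ l ρ) :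
    IndepFun (fun ω => ((fun i => (X.pos i ω, X.active i ω)), fun i => X.mark i ω))
      (fun ω => ((fun i => X.g i ω), X.h ω)) μ :=
  have := hX.bs_hppp.isProbabilityMeasure
  indepFun_prodMk_left hX.measurable_bs (measurable_pi_lambda _ hX.meas_mark)
    ((measurable_pi_lambda _ hX.meas_g).prodMk hX.meas_h) hX.indep_bs hX.indep_mark

lemma indep_bs_mark_g (hX : X.IsModel M μ l ρ) :
    IndepFun (fun ω => ((fun i => (X.pos i ω, X.active i ω)), fun i => X.mark i ω))
      (fun ω i => X.g i ω) μ :=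
  hX.indep_bs_mark_fading.comp (φ := id) (ψ := Prod.fst) measurable_id measurable_fst

lemma indep_load_h (hX : X.IsModel M μ l ρ) (hM : M.Admissible) :
    IndepFun (X.load M) X.h μ := by
  have := hX.bs_hppp.isProbabilityMeasure
  have henv : IndepFun X.environment X.h μ :=
    indepFun_prodMk_left hX.measurable_bs_mark (measurable_pi_lambda _ hX.meas_g) hX.meas_h
      hX.indep_bs_mark_fading hX.indep_fading
  have hload := (@IsMeasurable.load Ω M (MeasurableSpace.comap X.environment inferInstance) X
    X.isMeasurable_comap_environment hM).comap_le
  exact indep_of_indep_of_le_left henv hload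

lemma measure_lt_sinr (hX : X.IsModel M μ l ρ) (hM : M.Admissible) (hL : 0 < M.L) {γ : ℝ}
    (hγ : 0 < γ) :
    μ {ω | γ < X.sinr M ω} = ∫⁻ ω, nexp (ENNReal.ofReal γ * X.load M ω) ∂μ := by
  have := hX.bs_hppp.isProbabilityMeasure
  have hload : Measurable fun ω => ENNReal.ofReal γ * X.load M ω :=
    (hX.isMeasurable.load hM).const_mul _
  simp only [lt_sinr_iff hM hL hγ, measure_lt_ofReal_of_map_eq_expMeasure one_pos hload hX.meas_h
    ((hX.indep_load_h hM).comp (measurable_const_mul _) measurable_id) hX.h_law,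
    ENNReal.ofReal_one, one_mul]

lemma map_sinr_restrict_absolutelyContinuous (hX : X.IsModel M μ l ρ) (hM : M.Admissible)
    (hL : 0 < M.L) : (μ.map (X.sinr M)).restrict (Set.Ioi 0) ≪ volume := by
  have := hX.bs_hppp.isProbabilityMeasure
  refine Measure.AbsolutelyContinuous.mk fun A hA hA0 => ?_
  rw [Measure.restrict_apply hA, Measure.map_apply (hX.isMeasurable.sinr hM hX.meas_h)
    (hA.inter measurableSet_Ioi)]
  have hload : Measurable fun ω => (X.load M ω)⁻¹.toReal :=
    (hX.isMeasurable.load hM).inv.ennreal_toReal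
  have hnull := measure_mul_mem_eq_zero hload hX.meas_h
    ((hX.indep_load_h hM).comp measurable_inv.ennreal_toReal measurable_id)
    (hX.h_law ▸ expMeasure_absolutelyContinuous 1) hA0
  refine measure_mono_null (fun ω ⟨hωA, (hω : 0 < X.sinr M ω)⟩ => ?_) hnull
  rw [Set.mem_ofPred_eq, ← sinr_eq_mul_of_pos hM hL hω]
  exact ⟨hωA, hω.ne'⟩

end IsModel

end Network

lemma setLIntegral_Icc_ite {p : ℝ} (hp : p ∈ Set.Icc (0 : ℝ) 1) (α β : ℝ≥0∞) :
    ∫⁻ u in Set.Icc (0 : ℝ) 1, (if u ≤ p then α else β) =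
      ENNReal.ofReal p * α + ENNReal.ofReal (1 - p) * β := by
  have hdisj : Disjoint (Set.Icc 0 p) (Set.Ioc p 1) :=
    Set.disjoint_left.2 fun _ hu hu' => hu.2.not_gt hu'.1
  rw [← Set.Icc_union_Ioc_eq_Icc hp.1 hp.2, lintegral_union measurableSet_Ioc hdisj,
    setLIntegral_congr_fun (g := fun _ => α) measurableSet_Icc fun _ hu => if_pos hu.2,
    setLIntegral_congr_fun (g := fun _ => β) measurableSet_Ioc fun _ hu => if_neg hu.1.not_ge]
  simp [mul_comm]

lemma one_sub_add_ofReal_one_div {p a b : ℝ} (hp : p ∈ Set.Icc (0 : ℝ) 1) (ha : 0 ≤ a)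
    (hb : 0 ≤ b) :
    1 - (ENNReal.ofReal p * ENNReal.ofReal (1 / (1 + a)) +
      ENNReal.ofReal (1 - p) * ENNReal.ofReal (1 / (1 + b))) =
    ENNReal.ofReal (p * (a / (1 + a)) + (1 - p) * (b / (1 + b))) := by
  have hp0 := hp.1
  have hp1 : 0 ≤ 1 - p := sub_nonneg.2 hp.2
  rw [← ENNReal.ofReal_mul hp0, ← ENNReal.ofReal_mul hp1, ← ENNReal.ofReal_add (by positivity)
    (by positivity), ← ENNReal.ofReal_one, ← ENNReal.ofReal_sub _ (by positivity)]
  congr 1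
  field_simp
  ring

namespace RadioModel

variable {M : RadioModel}

/-- The Laplace transform at `s` of the interference from an active BS at `x`, averaged over the
line-of-sight mark and the exponential fading. -/
noncomputable def linkLaplace (M : RadioModel) (s : ℝ) (x : Plane) : ℝ≥0∞ :=
  ∫⁻ u in Set.Icc (0 : ℝ) 1, ENNReal.ofReal (1 / (1 + s * M.P * M.linkGain x u))

/-- The exponent of the Laplace transform at `s` of the total interference, per unit density of
active BSs. -/
noncomputable def interfExponent (M : RadioModel) (s : ℝ) : ℝ≥0∞ :=
  ENNReal.ofReal (2 * Real.pi) *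
    (M.interfIntegral M.prLoS M.gainL s + M.interfIntegral (fun w => 1 - M.prLoS w) M.gainNL s)

/-- The exponent of the Laplace transform at `s` of interference plus noise, for active BSs of
density `dens`. -/
noncomputable def laplaceExponent (M : RadioModel) (dens s : ℝ) : ℝ≥0∞ :=
  ENNReal.ofReal dens * M.interfExponent s + ENNReal.ofReal s * ENNReal.ofReal M.PN

lemma interfIntegral_mul_le (hP : 0 ≤ M.P) {p ζ : ℝ → ℝ} (hp : ∀ w, M.L ≤ w → 0 ≤ p w)
    (hζ : ∀ w, M.L ≤ w → 0 ≤ ζ w) {s c : ℝ} (hs : 0 ≤ s) (hc : 1 ≤ c) :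
    M.interfIntegral p ζ (c * s) ≤ ENNReal.ofReal c * M.interfIntegral p ζ s := by
  have hc0 : 0 ≤ c := zero_le_one.trans hc
  rw [interfIntegral, interfIntegral, ← lintegral_const_mul' _ _ ENNReal.ofReal_ne_top]
  refine setLIntegral_mono' measurableSet_Ioi fun u (hu : 0 < u) => ?_
  rw [← ENNReal.ofReal_mul hc0]
  refine ENNReal.ofReal_le_ofReal ?_
  set a := s * M.P * ζ (M.dist3 u) with ha_def
  have ha : 0 ≤ a := mul_nonneg (mul_nonneg hs hP) (hζ _ (M.le_dist3 u))
  have hfrac : c * a / (1 + c * a) ≤ c * a / (1 + a) :=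
    div_le_div_of_nonneg_left (by positivity) (by positivity)
      (add_le_add_right (le_mul_of_one_le_left ha hc) 1)
  calc p (M.dist3 u) * u * (c * s * M.P * ζ (M.dist3 u) / (1 + c * s * M.P * ζ (M.dist3 u)))
      = p (M.dist3 u) * u * (c * a / (1 + c * a)) := by rw [ha_def]; ring_nf
    _ ≤ p (M.dist3 u) * u * (c * a / (1 + a)) :=
        mul_le_mul_of_nonneg_left hfrac (mul_nonneg (hp _ (M.le_dist3 u)) hu.le)
    _ = c * (p (M.dist3 u) * u * (a / (1 + a))) := by ring

namespace Admissible

lemma interfExponent_mul_le (hM : M.Admissible) (hL : 0 < M.L) {s c : ℝ} (hs : 0 ≤ s)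
    (hc : 1 ≤ c) : M.interfExponent (c * s) ≤ ENNReal.ofReal c * M.interfExponent s := by
  rw [interfExponent, interfExponent, mul_left_comm, mul_add (ENNReal.ofReal c)]
  gcongr
  · exact interfIntegral_mul_le hM.P_pos.le (fun w hw => (hM.prLoS_mem w hw).1)
      (fun w hw => (hM.gainL_pos (hL.trans_le hw)).le) hs hc
  · exact interfIntegral_mul_le hM.P_pos.le (fun w hw => sub_nonneg.2 (hM.prLoS_mem w hw).2)
      (fun w hw => (hM.gainNL_pos (hL.trans_le hw)).le) hs hc

lemma laplaceExponent_mul_le (hM : M.Admissible) (hL : 0 < M.L) (dens : ℝ) {s c : ℝ} (hs : 0 ≤ s)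
    (hc : 1 ≤ c) :
    M.laplaceExponent dens (c * s) ≤ ENNReal.ofReal c * M.laplaceExponent dens s := by
  rw [laplaceExponent, laplaceExponent, ENNReal.ofReal_mul (zero_le_one.trans hc), mul_add,
    mul_left_comm (ENNReal.ofReal c), mul_assoc]
  gcongr
  exact hM.interfExponent_mul_le hL hs hc

lemma one_sub_linkLaplace (hM : M.Admissible) (hL : 0 < M.L) {s : ℝ} (hs : 0 ≤ s) (x : Plane) :
    1 - M.linkLaplace s x = ENNReal.ofReal
      (M.prLoS (M.dist3 ‖x‖) *
          (s * M.P * M.gainL (M.dist3 ‖x‖) / (1 + s * M.P * M.gainL (M.dist3 ‖x‖))) +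
        (1 - M.prLoS (M.dist3 ‖x‖)) *
          (s * M.P * M.gainNL (M.dist3 ‖x‖) / (1 + s * M.P * M.gainNL (M.dist3 ‖x‖)))) := by
  have hsP : 0 ≤ s * M.P := mul_nonneg hs hM.P_pos.le
  have hd := hL.trans_le (M.le_dist3 ‖x‖)
  have hp := hM.prLoS_mem _ (M.le_dist3 ‖x‖)
  rw [← one_sub_add_ofReal_one_div hp (mul_nonneg hsP (hM.gainL_pos hd).le)
    (mul_nonneg hsP (hM.gainNL_pos hd).le), ← setLIntegral_Icc_ite hp]
  simp only [linkLaplace, linkGain, apply_ite fun g => ENNReal.ofReal (1 / (1 + s * M.P * g))]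

lemma lintegral_one_sub_linkLaplace (hM : M.Admissible) (hL : 0 < M.L) {s : ℝ} (hs : 0 ≤ s) :
    ∫⁻ x, (1 - M.linkLaplace s x) = M.interfExponent s := by
  set p : ℝ → ℝ := fun u => M.prLoS (M.dist3 u)
  set a : ℝ → ℝ := fun u => s * M.P * M.gainL (M.dist3 u)
  set b : ℝ → ℝ := fun u => s * M.P * M.gainNL (M.dist3 u)
  have hp : Measurable p := hM.measurable_prLoS_dist3
  have ha : Measurable a := by fun_prop
  have hb : Measurable b := by fun_prop
  have hsP : 0 ≤ s * M.P := mul_nonneg hs hM.P_pos.le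
  have ha0 : ∀ u, 0 ≤ a u := fun u => mul_nonneg hsP (hM.gainL_pos (hL.trans_le (M.le_dist3 u))).le
  have hb0 : ∀ u, 0 ≤ b u := fun u => mul_nonneg hsP (hM.gainNL_pos (hL.trans_le (M.le_dist3 u))).le
  have hsplit : ∀ u, 0 < u →
      ENNReal.ofReal u * ENNReal.ofReal (p u * (a u / (1 + a u)) + (1 - p u) * (b u / (1 + b u))) =
        ENNReal.ofReal (p u * u * (a u / (1 + a u))) +
          ENNReal.ofReal ((1 - p u) * u * (b u / (1 + b u))) := by
    intro u hu
    obtain ⟨hp0, hp1⟩ := hM.prLoS_mem _ (M.le_dist3 u)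
    have : 0 ≤ 1 - p u := sub_nonneg.2 hp1
    have := ha0 u
    have := hb0 u
    rw [← ENNReal.ofReal_mul hu.le, ← ENNReal.ofReal_add (by positivity) (by positivity)]
    ring_nf
  calc ∫⁻ x, (1 - M.linkLaplace s x)
      = ∫⁻ x : Plane, ENNReal.ofReal (p ‖x‖ * (a ‖x‖ / (1 + a ‖x‖)) +
          (1 - p ‖x‖) * (b ‖x‖ / (1 + b ‖x‖))) := lintegral_congr (hM.one_sub_linkLaplace hL hs)
    _ = ENNReal.ofReal (2 * Real.pi) * ∫⁻ u in Set.Ioi (0 : ℝ), ENNReal.ofReal u *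
          ENNReal.ofReal (p u * (a u / (1 + a u)) + (1 - p u) * (b u / (1 + b u))) :=
        lintegral_plane_norm (f := fun u => ENNReal.ofReal
          (p u * (a u / (1 + a u)) + (1 - p u) * (b u / (1 + b u)))) (by fun_prop)
    _ = M.interfExponent s := by
        rw [setLIntegral_congr_fun measurableSet_Ioi hsplit, lintegral_add_left (by fun_prop)]
        rfl

lemma coverageLimit_eq (hM : M.Admissible) (hL : 0 < M.L) {ρ γ : ℝ} (hρ : 0 ≤ ρ) (hγ : 0 ≤ γ) :
    M.coverageLimit ρ γ = (nexp (M.laplaceExponent ρ (γ / (M.P * M.peakGain)))).toReal := by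
  have hs : 0 ≤ γ / (M.P * M.peakGain) :=
    div_nonneg hγ (mul_pos hM.P_pos (hM.peakGain_pos hL)).le
  rw [coverageLimit, laplaceLimit, expNeg_eq_toReal_nexp, expNeg_eq_toReal_nexp,
    ← ENNReal.toReal_mul, ← nexp_add, ← mul_add, laplaceExponent, nexp_add, ENNReal.toReal_mul,
    ← ENNReal.ofReal_mul hs, nexp_ofReal (mul_nonneg hs hM.PN_pos.le),
    ENNReal.toReal_ofReal (Real.exp_pos _).le, interfExponent, ← mul_assoc, ← ENNReal.ofReal_mul hρ,
    mul_comm ρ, mul_comm (Real.exp _)]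
  ring_nf

end Admissible

end RadioModel

namespace Network

variable {Ω : Type*} {X : Network Ω} {M : RadioModel}

/-- The interference from all active BSs, including the serving one if it is active. -/
noncomputable def totalInterference (X : Network Ω) (M : RadioModel) (ω : Ω) : ℝ≥0∞ :=
  ∑' i, if X.active i ω = true then ENNReal.ofReal (M.P * X.gain M i ω * X.g i ω) else 0

lemma interference_eq_totalInterference {ω : Ω} (h : X.active (X.serving M ω) ω ≠ true) :
    X.interference M ω = X.totalInterference M ω := by
  refine tsum_congr fun i => if_congr (and_iff_left_of_imp ?_) rfl rfl
  rintro hi rfl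
  exact h hi

lemma nexp_mul_totalInterference {s : ℝ} (hs : 0 ≤ s) (ω : Ω) :
    nexp (ENNReal.ofReal s * X.totalInterference M ω) = infProd fun i =>
      if X.active i ω = true then
        nexp (ENNReal.ofReal (s * M.P * M.linkGain (X.pos i ω) (X.mark i ω) * X.g i ω)) else 1 := by
  simp only [totalInterference, ← ENNReal.tsum_mul_left, nexp_tsum, mul_ite, mul_zero,
    apply_ite nexp, nexp_zero, ← ENNReal.ofReal_mul hs, gain_eq_linkGain, mul_assoc]

variable [MeasurableSpace Ω] {μ : Measure Ω} {l ρ : ℝ}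

namespace IsModel

lemma lintegral_nexp_totalInterference_eq_infProd (hX : X.IsModel M μ l ρ) (hM : M.Admissible)
    (hL : 0 < M.L) {s : ℝ} (hs : 0 ≤ s) :
    ∫⁻ ω, nexp (ENNReal.ofReal s * X.totalInterference M ω) ∂μ =
      ∫⁻ ω, infProd (fun i => if X.active i ω = true then
        ENNReal.ofReal (1 / (1 + s * M.P * M.linkGain (X.pos i ω) (X.mark i ω))) else 1) ∂μ := by
  have := isProbabilityMeasure_expMeasure one_pos
  have hF : ∀ i : ℕ, Measurable (Function.uncurry
      fun (u : (ℕ → Plane × Bool) × (ℕ → ℝ)) (t : ℝ) => if (u.1 i).2 = true then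
        nexp (ENNReal.ofReal (s * M.P * M.linkGain (u.1 i).1 (u.2 i) * t)) else 1) := fun i => by
    have hactive : Measurable fun y : ((ℕ → Plane × Bool) × (ℕ → ℝ)) × ℝ => (y.1.1 i).2 := by
      fun_prop
    have hgain : Measurable fun y : ((ℕ → Plane × Bool) × (ℕ → ℝ)) × ℝ =>
        M.linkGain (y.1.1 i).1 (y.1.2 i) :=
      hM.measurable_linkGain.comp (f := fun y : ((ℕ → Plane × Bool) × (ℕ → ℝ)) × ℝ =>
        ((y.1.1 i).1, y.1.2 i)) (by fun_prop)
    exact Measurable.ite (hactive (measurableSet_singleton true)) (by fun_prop) measurable_const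
  have haverage : ∀ ω i, ∫⁻ t, (if X.active i ω = true then
      nexp (ENNReal.ofReal (s * M.P * M.linkGain (X.pos i ω) (X.mark i ω) * t)) else 1)
        ∂(expMeasure 1) = if X.active i ω = true then
      ENNReal.ofReal (1 / (1 + s * M.P * M.linkGain (X.pos i ω) (X.mark i ω))) else 1 := by
    intro ω i
    split_ifs
    · exact lintegral_nexp_expMeasure one_pos
        (mul_nonneg (mul_nonneg hs hM.P_pos.le) (hM.linkGain_pos hL _ _).le)
    · simp
  simp only [nexp_mul_totalInterference hs]
  rw [lintegral_infProd_of_iIndepFun hX.measurable_bs_mark hX.meas_g hX.g_indep hX.indep_bs_mark_g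
    hF fun i u t => by
      split_ifs
      exacts [nexp_le_one _, le_rfl]]
  simp only [hX.g_law, haverage]

lemma lintegral_nexp_totalInterference (hX : X.IsModel M μ l ρ) (hM : M.Admissible) (hL : 0 < M.L)
    {s : ℝ} (hs : 0 ≤ s) :
    ∫⁻ ω, nexp (ENNReal.ofReal s * X.totalInterference M ω) ∂μ =
      nexp (ENNReal.ofReal (M.activeDensity ρ l) * M.interfExponent s) := by
  have hmeas : Measurable (Function.uncurry
      fun x u => ENNReal.ofReal (1 / (1 + s * M.P * M.linkGain x u))) :=
    ((hM.measurable_linkGain.const_mul (s * M.P)).const_add 1 |>.const_div 1).ennreal_ofReal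
  have hle : ∀ x u, ENNReal.ofReal (1 / (1 + s * M.P * M.linkGain x u)) ≤ 1 := fun x u => by
    have hx : 0 ≤ s * M.P * M.linkGain x u :=
      mul_nonneg (mul_nonneg hs hM.P_pos.le) (hM.linkGain_pos hL x u).le
    exact ENNReal.ofReal_le_one.2 (div_le_one_of_le₀ (by linarith) (by linarith))
  rw [hX.lintegral_nexp_totalInterference_eq_infProd hM hL hs,
    hX.active_hppp.lintegral_infProd_marked hX.meas_pos hX.meas_active hX.meas_mark hX.mark_indep
      hX.indep_bs_mark hX.mark_law hmeas hle, ← hM.lintegral_one_sub_linkLaplace hL hs]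
  rfl

lemma lintegral_nexp_totalInterference_add_noise (hX : X.IsModel M μ l ρ) (hM : M.Admissible)
    (hL : 0 < M.L) {s : ℝ} (hs : 0 ≤ s) :
    ∫⁻ ω, nexp (ENNReal.ofReal s * (X.totalInterference M ω + ENNReal.ofReal M.PN)) ∂μ =
      nexp (M.laplaceExponent (M.activeDensity ρ l) s) := by
  simp only [mul_add, nexp_add]
  rw [lintegral_mul_const' _ _ (nexp_ne_top _), hX.lintegral_nexp_totalInterference hM hL hs,
    RadioModel.laplaceExponent, nexp_add]

end IsModel

end Network

lemma lintegral_nexp_le_add_measure {Ω : Type*} [MeasurableSpace Ω] {μ : Measure Ω}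
    {f g : Ω → ℝ≥0∞} (hg : Measurable g) {E : Set Ω} (h : ∀ ω ∈ E, g ω ≤ f ω) :
    ∫⁻ ω, nexp (f ω) ∂μ ≤ ∫⁻ ω, nexp (g ω) ∂μ + μ Eᶜ := by
  have hpt : ∀ ω, nexp (f ω) ≤ nexp (g ω) + Eᶜ.indicator 1 ω := fun ω => by
    by_cases hω : ω ∈ E
    · exact (nexp_antitone (h ω hω)).trans le_self_add
    · rw [Set.indicator_of_mem (Set.mem_compl hω)]
      exact (nexp_le_one _).trans le_add_self
  calc ∫⁻ ω, nexp (f ω) ∂μ ≤ ∫⁻ ω, (nexp (g ω) + Eᶜ.indicator 1 ω) ∂μ := lintegral_mono hpt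
    _ = ∫⁻ ω, nexp (g ω) ∂μ + ∫⁻ ω, Eᶜ.indicator 1 ω ∂μ := lintegral_add_left (by fun_prop) _
    _ ≤ ∫⁻ ω, nexp (g ω) ∂μ + μ Eᶜ := by
        gcongr
        exact lintegral_indicator_one_le _

namespace Network

variable {Ω : Type*} {X : Network Ω} {M : RadioModel}

/-- The event that the gain of the serving BS is at least `t` and that this BS is not active, so
that the interference is the total one. -/
def servedByIdle (X : Network Ω) (M : RadioModel) (t : ℝ) : Set Ω :=
  {ω | t ≤ X.gain M (X.serving M ω) ω ∧ X.active (X.serving M ω) ω ≠ true}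

lemma gain_le_gain_serving {t : ℝ} {ω : Ω} (hfin : {j | t ≤ X.gain M j ω}.Finite)
    (hne : {j | t ≤ X.gain M j ω}.Nonempty) (j : ℕ) :
    X.gain M j ω ≤ X.gain M (X.serving M ω) ω := by
  obtain ⟨o, ho, hmax⟩ := Set.exists_max_image _ (fun j => X.gain M j ω) hfin hne
  have hserving : {i | ∀ j, X.gain M j ω ≤ X.gain M i ω}.Nonempty := ⟨o, fun j =>
    (le_total t (X.gain M j ω)).elim (hmax j) fun hj => hj.trans ho⟩
  exact Nat.sInf_mem hserving j

lemma mem_servedByIdle {t : ℝ} {ω : Ω} (hcount : pointCount X.pos (fun _ _ => true)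
      (M.strongSet t) ω ≠ ⊤) (hstrong : ∃ i, (X.pos i ω, X.mark i ω) ∈ M.strongLinks t)
    (hidle : ∀ i, X.active i ω = true → X.pos i ω ∉ M.strongSet t) :
    ω ∈ X.servedByIdle M t := by
  obtain ⟨i, hi⟩ := hstrong
  have hfin : {j | t ≤ X.gain M j ω}.Finite :=
    (Set.encard_ne_top_iff.1 hcount).subset fun j hj =>
      ⟨rfl, RadioModel.mem_strongSet_of_le_linkGain hj⟩
  have hserving : t ≤ X.gain M (X.serving M ω) ω :=
    le_trans hi (gain_le_gain_serving hfin ⟨i, hi⟩ i)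
  exact ⟨hserving, fun hactive =>
    hidle _ hactive (RadioModel.mem_strongSet_of_le_linkGain hserving)⟩

lemma ofReal_mul_load {γ : ℝ} {ω : Ω} (hP : 0 < M.P)
    (hgain : 0 < X.gain M (X.serving M ω) ω) :
    ENNReal.ofReal γ * X.load M ω =
      ENNReal.ofReal (γ / (M.P * X.gain M (X.serving M ω) ω)) *
        (X.interference M ω + ENNReal.ofReal M.PN) := by
  rw [load, ENNReal.ofReal_div_of_pos (mul_pos hP hgain), ENNReal.div_eq_inv_mul,
    ENNReal.div_eq_inv_mul, mul_left_comm, mul_assoc]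

lemma le_ofReal_mul_load (hM : M.Admissible) (hL : 0 < M.L) {γ t : ℝ} (hγ : 0 ≤ γ) {ω : Ω}
    (hω : ω ∈ X.servedByIdle M t) :
    ENNReal.ofReal (γ / (M.P * M.peakGain)) *
      (X.totalInterference M ω + ENNReal.ofReal M.PN) ≤ ENNReal.ofReal γ * X.load M ω := by
  have hgain := gain_pos (X := X) hM hL (X.serving M ω) ω
  have hP := hM.P_pos
  rw [ofReal_mul_load hP hgain, interference_eq_totalInterference hω.2]
  gcongr
  exact gain_le hM _ _

lemma ofReal_mul_load_le (hP : 0 < M.P) {γ t : ℝ} (hγ : 0 ≤ γ) (ht : 0 < t)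
    {ω : Ω} (hω : ω ∈ X.servedByIdle M t) :
    ENNReal.ofReal γ * X.load M ω ≤ ENNReal.ofReal (γ / (M.P * t)) *
      (X.totalInterference M ω + ENNReal.ofReal M.PN) := by
  rw [ofReal_mul_load hP (ht.trans_le hω.1), interference_eq_totalInterference hω.2]
  gcongr
  exact hω.1

variable [MeasurableSpace Ω] {μ : Measure Ω} {l ρ : ℝ}

lemma IsMeasurable.totalInterference (hX : X.IsMeasurable) (hM : M.Admissible) :
    Measurable (X.totalInterference M) :=
  Measurable.tsum fun i => Measurable.ite (hX.active i (measurableSet_singleton true))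
    (((hX.gain hM i).const_mul _).mul (hX.g i)).ennreal_ofReal measurable_const

namespace IsModel

lemma measure_compl_servedByIdle_le (hX : X.IsModel M μ l ρ) (hM : M.Admissible) {t : ℝ}
    (ht : 0 < t) :
    μ (X.servedByIdle M t)ᶜ ≤ nexp (ENNReal.ofReal l *
        (volume.prod (volume.restrict (Set.Icc (0 : ℝ) 1))) (M.strongLinks t)) +
      (1 - nexp (ENNReal.ofReal (M.activeDensity ρ l) * volume (M.strongSet t))) := by
  have := hX.bs_hppp.isProbabilityMeasure
  have hD := M.measurableSet_strongSet t
  have hvD := hM.volume_strongSet_ne_top ht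
  set W := {ω | ∀ i, true = true → (X.pos i ω, X.mark i ω) ∉ M.strongLinks t}
  set I := {ω | ∀ i, X.active i ω = true → X.pos i ω ∉ M.strongSet t}
  have hI : MeasurableSet I := by
    simp only [I, Set.ofPred_forall]
    exact .iInter fun i => (hX.meas_active i (measurableSet_singleton true)).imp
      (hX.meas_pos i hD).compl
  have hsub : (X.servedByIdle M t)ᶜ ≤ᵐ[μ] (W ∪ Iᶜ : Set Ω) := by
    filter_upwards [hX.bs_hppp.ae_pointCount_ne_top hX.meas_pos (fun _ => measurable_const) hD hvD]
      with ω hcount hω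
    by_contra hWI
    obtain ⟨hW, hIω⟩ := not_or.1 hWI
    have hstrong : ∃ i, (X.pos i ω, X.mark i ω) ∈ M.strongLinks t := by
      simpa [W] using hW
    exact hω (mem_servedByIdle hcount hstrong (not_not.1 hIω))
  have hindep : IndepFun (fun ω i => (X.pos i ω, true)) (fun ω i => X.mark i ω) μ :=
    hX.indep_bs_mark.comp (φ := fun (u : ℕ → Plane × Bool) i => ((u i).1, true)) (by fun_prop)
      measurable_id
  calc μ (X.servedByIdle M t)ᶜ ≤ μ W + μ Iᶜ := (measure_mono_ae hsub).trans (measure_union_le _ _)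
    _ = _ := by
      rw [prob_compl_eq_one_sub hI, hX.active_hppp.measure_void hD hvD,
        hX.bs_hppp.measure_void_marked hX.meas_pos (fun _ => measurable_const) hX.meas_mark
          hX.mark_indep hindep hX.mark_law (hM.measurableSet_strongLinks t)]

lemma measure_lt_sinr_le (hX : X.IsModel M μ l ρ) (hM : M.Admissible) (hL : 0 < M.L) {γ : ℝ}
    (hγ : 0 < γ) (t : ℝ) :
    μ {ω | γ < X.sinr M ω} ≤
      nexp (M.laplaceExponent (M.activeDensity ρ l) (γ / (M.P * M.peakGain))) +
        μ (X.servedByIdle M t)ᶜ := by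
  rw [hX.measure_lt_sinr hM hL hγ, ← hX.lintegral_nexp_totalInterference_add_noise hM hL
    (div_nonneg hγ.le (mul_pos hM.P_pos (hM.peakGain_pos hL)).le)]
  exact lintegral_nexp_le_add_measure
    (((hX.isMeasurable.totalInterference hM).add_const _).const_mul _)
    fun ω hω => le_ofReal_mul_load hM hL hγ.le hω

lemma le_measure_lt_sinr (hX : X.IsModel M μ l ρ) (hM : M.Admissible) (hL : 0 < M.L) {γ : ℝ}
    (hγ : 0 < γ) {t : ℝ} (ht : 0 < t) (htpeak : t ≤ M.peakGain) :
    nexp (ENNReal.ofReal (M.peakGain / t) *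
        M.laplaceExponent (M.activeDensity ρ l) (γ / (M.P * M.peakGain))) -
      μ (X.servedByIdle M t)ᶜ ≤ μ {ω | γ < X.sinr M ω} := by
  have hP := hM.P_pos
  have hpeak := hM.peakGain_pos hL
  have hs : γ / (M.P * t) = M.peakGain / t * (γ / (M.P * M.peakGain)) := by field_simp
  refine tsub_le_iff_right.2 ?_
  calc nexp (ENNReal.ofReal (M.peakGain / t) *
        M.laplaceExponent (M.activeDensity ρ l) (γ / (M.P * M.peakGain)))
      ≤ nexp (M.laplaceExponent (M.activeDensity ρ l) (γ / (M.P * t))) := by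
        rw [hs]
        exact nexp_antitone (hM.laplaceExponent_mul_le hL _ (by positivity)
          ((one_le_div ht).2 htpeak))
    _ = ∫⁻ ω, nexp (ENNReal.ofReal (γ / (M.P * t)) *
          (X.totalInterference M ω + ENNReal.ofReal M.PN)) ∂μ :=
        (hX.lintegral_nexp_totalInterference_add_noise hM hL (by positivity)).symm
    _ ≤ μ {ω | γ < X.sinr M ω} + μ (X.servedByIdle M t)ᶜ := by
        rw [hX.measure_lt_sinr hM hL hγ]
        exact lintegral_nexp_le_add_measure ((hX.isMeasurable.load hM).const_mul _)
          fun ω hω => ofReal_mul_load_le hP hγ.le ht hω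

end IsModel

end Network

lemma tendsto_nexp_ofReal_mul_atTop {c : ℝ≥0∞} (hc : c ≠ 0) :
    Tendsto (fun l : ℝ => nexp (ENNReal.ofReal l * c)) atTop (𝓝 0) := by
  have h := ENNReal.Tendsto.mul_const (b := c) ENNReal.tendsto_ofReal_atTop
    (.inl ENNReal.top_ne_zero)
  rw [ENNReal.top_mul hc] at h
  simpa only [nexp_top, Function.comp_def] using (continuous_nexp.tendsto _).comp h

section Curry

variable {α β γ : Type*} {la : Filter α} {lb : Filter β} {lc : Filter γ}

lemma tendsto_comp_fst_curry {f : α → γ} (h : Tendsto f la lc) :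
    Tendsto (fun p : α × β => f p.1) (la.curry lb) lc :=
  (h.comp tendsto_fst).mono_left curry_le_prod

lemma tendsto_comp_snd_curry {f : β → γ} (h : Tendsto f lb lc) :
    Tendsto (fun p : α × β => f p.2) (la.curry lb) lc :=
  (h.comp tendsto_snd).mono_left curry_le_prod

lemma tendsto_of_tendsto_comp_snd_curry [la.NeBot] {f : β → γ}
    (h : Tendsto (fun p : α × β => f p.2) (la.curry lb) lc) : Tendsto f lb lc :=
  fun _ hs => eventually_const.1 (eventually_curry_iff.1 (h hs))

end Curry

namespace RadioModel

variable {M : RadioModel} {ρ : ℝ}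

lemma Admissible.tendsto_laplaceExponent (hM : M.Admissible) (hρ : 0 < ρ) (s : ℝ) :
    Tendsto (fun l => M.laplaceExponent (M.activeDensity ρ l) s) atTop
      (𝓝 (M.laplaceExponent ρ s)) :=
  (ENNReal.Tendsto.mul_const (ENNReal.tendsto_ofReal (hM.tendsto_activeDensity ρ))
    (.inl (ENNReal.ofReal_pos.2 hρ).ne')).add_const _

end RadioModel

namespace Network

variable {M : RadioModel} {ρ : ℝ} {Ω : ℝ → Type*} [∀ l, MeasurableSpace (Ω l)]
  {μ : ∀ l, Measure (Ω l)} {X : ∀ l, Network (Ω l)}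

-- For fixed `t`, letting `l → ∞` produces a link of gain at least `t`; letting `t ↑ peakGain` next
-- shrinks the region that can hold such links until it contains no active BS.
lemma tendsto_measure_compl_servedByIdle (hM : M.Admissible) (hL : 0 < M.L)
    (hX : ∀ l, 0 < l → (X l).IsModel M (μ l) l ρ) :
    Tendsto (fun p : ℝ × ℝ => μ p.2 ((X p.2).servedByIdle M p.1)ᶜ)
      ((𝓝[<] M.peakGain).curry atTop) (𝓝 0) := by
  have hnoStrong : Tendsto (fun p : ℝ × ℝ => nexp (ENNReal.ofReal p.2 *
      (volume.prod (volume.restrict (Set.Icc (0 : ℝ) 1))) (M.strongLinks p.1)))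
      ((𝓝[<] M.peakGain).curry atTop) (𝓝 0) :=
    fun _ hs => eventually_mem_nhdsWithin.mono fun t ht =>
      tendsto_nexp_ofReal_mul_atTop (hM.prod_strongLinks_pos hL ht).ne' hs
  have hactive : Tendsto (fun p : ℝ × ℝ => 1 - nexp (ENNReal.ofReal (M.activeDensity ρ p.2) *
      volume (M.strongSet p.1))) ((𝓝[<] M.peakGain).curry atTop) (𝓝 0) := by
    have hdens := tendsto_comp_snd_curry (la := 𝓝[<] M.peakGain)
      (ENNReal.tendsto_ofReal (hM.tendsto_activeDensity ρ))
    have hvol := tendsto_comp_fst_curry (lb := (atTop : Filter ℝ)) (hM.tendsto_volume_strongSet hL)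
    have hmean := ENNReal.Tendsto.mul hdens (.inr ENNReal.zero_ne_top) hvol
      (.inr ENNReal.ofReal_ne_top)
    simpa only [mul_zero, nexp_zero, tsub_self, Function.comp_def] using ENNReal.Tendsto.sub
      (tendsto_const_nhds (x := (1 : ℝ≥0∞))) ((continuous_nexp.tendsto _).comp hmean)
      (.inl ENNReal.one_ne_top)
  refine tendsto_of_tendsto_of_tendsto_of_le_of_le' tendsto_const_nhds
    (by simpa only [add_zero] using hnoStrong.add hactive) (.of_forall fun _ => zero_le) ?_
  have hpos : Set.Ioi 0 ×ˢ Set.Ioi 0 ∈ (𝓝[<] M.peakGain).curry (atTop : Filter ℝ) :=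
    prod_mem_curry (mem_nhdsWithin_of_mem_nhds (Ioi_mem_nhds (hM.peakGain_pos hL)))
      (Ioi_mem_atTop 0)
  filter_upwards [hpos] with p hp
  exact (hX p.2 hp.2).measure_compl_servedByIdle_le hM hp.1

lemma tendsto_measure_lt_sinr (hM : M.Admissible) (hL : 0 < M.L) (hρ : 0 < ρ)
    (hX : ∀ l, 0 < l → (X l).IsModel M (μ l) l ρ) {γ : ℝ} (hγ : 0 < γ) :
    Tendsto (fun l => μ l {ω | γ < (X l).sinr M ω}) atTop
      (𝓝 (nexp (M.laplaceExponent ρ (γ / (M.P * M.peakGain))))) := by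
  have hpeak := hM.peakGain_pos hL
  have hpos : Set.Ioo 0 M.peakGain ×ˢ Set.Ioi 0 ∈ (𝓝[<] M.peakGain).curry (atTop : Filter ℝ) :=
    prod_mem_curry (Ioo_mem_nhdsLT hpeak) (Ioi_mem_atTop 0)
  have hbad := tendsto_measure_compl_servedByIdle hM hL hX
  have hexp := tendsto_comp_snd_curry (la := 𝓝[<] M.peakGain)
    (hM.tendsto_laplaceExponent hρ (γ / (M.P * M.peakGain)))
  have hratio : Tendsto (fun p : ℝ × ℝ => ENNReal.ofReal (M.peakGain / p.1))
      ((𝓝[<] M.peakGain).curry atTop) (𝓝 1) := by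
    have h : Tendsto (fun t => ENNReal.ofReal (M.peakGain / t)) (𝓝 M.peakGain) (𝓝 1) := by
      simpa [hpeak.ne'] using
        ENNReal.tendsto_ofReal ((tendsto_const_nhds (x := M.peakGain)).div tendsto_id hpeak.ne')
    exact tendsto_comp_fst_curry (h.mono_left nhdsWithin_le_nhds)
  refine tendsto_of_tendsto_comp_snd_curry (la := 𝓝[<] M.peakGain)
    (tendsto_of_tendsto_of_tendsto_of_le_of_le' ?_ ?_
      (mem_of_superset hpos fun p hp => (hX p.2 hp.2).le_measure_lt_sinr hM hL hγ hp.1.1 hp.1.2.le)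
      (mem_of_superset hpos fun p hp => (hX p.2 hp.2).measure_lt_sinr_le hM hL hγ p.1))
  · have hlower := (continuous_nexp.tendsto _).comp
      (ENNReal.Tendsto.mul hratio (.inl one_ne_zero) hexp (.inr ENNReal.one_ne_top))
    simpa only [one_mul, tsub_zero, Function.comp_apply] using
      ENNReal.Tendsto.sub hlower hbad (.inl (nexp_ne_top _))
  · simpa only [add_zero, Function.comp_apply] using
      ((continuous_nexp.tendsto _).comp hexp).add hbad

lemma tendsto_coverage (hM : M.Admissible) (hL : 0 < M.L) (hρ : 0 < ρ)
    (hX : ∀ l, 0 < l → (X l).IsModel M (μ l) l ρ) {γ : ℝ} (hγ : 0 < γ) :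
    Tendsto (fun l => (X l).coverage M (μ l) γ) atTop (𝓝 (M.coverageLimit ρ γ)) := by
  rw [hM.coverageLimit_eq hL hρ.le hγ.le]
  exact (ENNReal.tendsto_toReal (nexp_ne_top _)).comp (tendsto_measure_lt_sinr hM hL hρ hX hγ)

end Network

section LayerCake

lemma lintegral_Ioi_lintegral_Ioo {ν μ : Measure ℝ} [SFinite ν] [SFinite μ] {g : ℝ → ℝ≥0∞}
    (hg : Measurable g) (a : ℝ) :
    ∫⁻ x in Set.Ioi a, ∫⁻ t in Set.Ioo a x, g t ∂μ ∂ν =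
      ∫⁻ t in Set.Ioi a, ν (Set.Ioi t) * g t ∂μ := by
  have hlt : MeasurableSet {p : ℝ × ℝ | p.2 < p.1} := measurableSet_lt measurable_snd measurable_fst
  calc ∫⁻ x in Set.Ioi a, ∫⁻ t in Set.Ioo a x, g t ∂μ ∂ν
      = ∫⁻ x in Set.Ioi a, ∫⁻ t in Set.Ioi a, (Set.Iio x).indicator g t ∂μ ∂ν := by
        simp only [setLIntegral_indicator measurableSet_Iio, Set.inter_comm (Set.Iio _),
          Set.Ioi_inter_Iio]
    _ = ∫⁻ t in Set.Ioi a, ∫⁻ x in Set.Ioi a, (Set.Ioi t).indicator (fun _ => g t) x ∂ν ∂μ :=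
        lintegral_lintegral_swap ((hg.comp measurable_snd).indicator hlt).aemeasurable
    _ = ∫⁻ t in Set.Ioi a, ν (Set.Ioi t) * g t ∂μ :=
        setLIntegral_congr_fun measurableSet_Ioi fun t ht => by
          rw [setLIntegral_indicator measurableSet_Ioi, setLIntegral_const, mul_comm,
            Set.inter_eq_left.2 (Set.Ioi_subset_Ioi (le_of_lt ht))]

lemma lintegral_Ioo_one_div_one_add {a b : ℝ} (ha : 0 ≤ a) (hab : a ≤ b) :
    ∫⁻ t in Set.Ioo a b, ENNReal.ofReal (1 / (1 + t)) =
      ENNReal.ofReal (Real.log (1 + b) - Real.log (1 + a)) := by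
  have hpos : ∀ t ∈ Set.uIcc a b, 0 < 1 + t := fun t ht => by
    rw [Set.uIcc_of_le hab] at ht
    linarith [ht.1]
  have hint : IntervalIntegrable (fun t : ℝ => 1 / (1 + t)) volume a b :=
    ContinuousOn.intervalIntegrable fun t ht =>
      (continuousAt_const.div (by fun_prop) (hpos t ht).ne').continuousWithinAt
  have hlog : ∫ t in a..b, 1 / (1 + t) = Real.log (1 + b) - Real.log (1 + a) :=
    intervalIntegral.integral_eq_sub_of_hasDerivAt
      (fun t ht => ((hasDerivAt_id' t).const_add 1).log (hpos t ht).ne') hint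
  rw [← hlog, intervalIntegral.integral_of_le hab, ofReal_integral_eq_lintegral_ofReal
    ((intervalIntegrable_iff_integrableOn_Ioc_of_le hab).1 hint)
    ((ae_restrict_mem measurableSet_Ioc).mono fun t ht =>
      div_nonneg zero_le_one (by linarith [ht.1])), restrict_Ioo_eq_restrict_Ioc]

lemma lintegral_Ioi_log_one_add (ν : Measure ℝ) [SFinite ν] {a : ℝ} (ha : 0 ≤ a) :
    ∫⁻ x in Set.Ioi a, ENNReal.ofReal (Real.log (1 + x)) ∂ν =
      ν (Set.Ioi a) * ENNReal.ofReal (Real.log (1 + a)) +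
        ∫⁻ t in Set.Ioi a, ν (Set.Ioi t) * ENNReal.ofReal (1 / (1 + t)) := by
  have hsplit : ∀ x ∈ Set.Ioi a, ENNReal.ofReal (Real.log (1 + x)) =
      ENNReal.ofReal (Real.log (1 + a)) +
        ∫⁻ t in Set.Ioo a x, ENNReal.ofReal (1 / (1 + t)) := fun x (hx : a < x) => by
    rw [lintegral_Ioo_one_div_one_add ha hx.le, ← ENNReal.ofReal_add
      (Real.log_nonneg (by linarith)) (sub_nonneg.2 (Real.log_le_log (by linarith) (by linarith))),
      add_sub_cancel]
  rw [setLIntegral_congr_fun measurableSet_Ioi hsplit, lintegral_add_left measurable_const,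
    setLIntegral_const, mul_comm, lintegral_Ioi_lintegral_Ioo (by fun_prop)]

lemma setLIntegral_rnDeriv_mul_of_restrict_absolutelyContinuous {α : Type*} [MeasurableSpace α]
    {ν μ : Measure α} [SigmaFinite ν] [SigmaFinite μ] {s : Set α} (hs : MeasurableSet s)
    (hν : ν.restrict s ≪ μ) {φ : α → ℝ≥0∞} (hφ : AEMeasurable φ μ) :
    ∫⁻ x in s, ν.rnDeriv μ x * φ x ∂μ = ∫⁻ x in s, φ x ∂ν := by
  rw [← lintegral_rnDeriv_mul hν hφ, ← lintegral_indicator hs]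
  refine lintegral_congr_ae ?_
  filter_upwards [Measure.rnDeriv_restrict ν μ hs] with x hx
  rw [hx, Set.indicator_mul_left]

variable {ν : Measure ℝ} [IsFiniteMeasure ν] {a : ℝ}

lemma lintegral_rnDeriv_mul_log (hν : ν.restrict (Set.Ioi a) ≪ volume) (ha : 0 ≤ a)
    (hint : IntegrableOn (fun t => ν.real (Set.Ioi t) / (1 + t)) (Set.Ioi a)) :
    ∫⁻ x in Set.Ioi a, ν.rnDeriv volume x * ENNReal.ofReal (Real.log (1 + x)) =
      ENNReal.ofReal (ν.real (Set.Ioi a) * Real.log (1 + a) +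
        ∫ t in Set.Ioi a, ν.real (Set.Ioi t) / (1 + t)) := by
  have hpos : ∀ t ∈ Set.Ioi a, 0 ≤ ν.real (Set.Ioi t) / (1 + t) := fun t (ht : a < t) =>
    div_nonneg measureReal_nonneg (by linarith)
  have htail : ∫⁻ t in Set.Ioi a, ν (Set.Ioi t) * ENNReal.ofReal (1 / (1 + t)) =
      ENNReal.ofReal (∫ t in Set.Ioi a, ν.real (Set.Ioi t) / (1 + t)) := by
    rw [ofReal_integral_eq_lintegral_ofReal hint ((ae_restrict_mem measurableSet_Ioi).mono hpos)]
    refine lintegral_congr fun t => ?_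
    rw [← ofReal_measureReal, ← ENNReal.ofReal_mul measureReal_nonneg, mul_one_div]
  rw [setLIntegral_rnDeriv_mul_of_restrict_absolutelyContinuous measurableSet_Ioi hν
      (by fun_prop), lintegral_Ioi_log_one_add ν ha, htail, ← ofReal_measureReal,
    ← ENNReal.ofReal_mul measureReal_nonneg, ENNReal.ofReal_add
      (mul_nonneg measureReal_nonneg (Real.log_nonneg (by linarith)))
      (setIntegral_nonneg measurableSet_Ioi hpos)]

lemma logb_mul_rnDeriv_eq (ν : Measure ℝ) {x : ℝ} (hx : 0 ≤ x) :
    Real.logb 2 (1 + x) * (ν.rnDeriv volume x).toReal =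
      (ν.rnDeriv volume x * ENNReal.ofReal (Real.log (1 + x))).toReal / Real.log 2 := by
  rw [Real.logb, ENNReal.toReal_mul, ENNReal.toReal_ofReal (Real.log_nonneg (by linarith))]
  ring

lemma integrableOn_logb_mul_rnDeriv (hν : ν.restrict (Set.Ioi a) ≪ volume) (ha : 0 ≤ a)
    (hint : IntegrableOn (fun t => ν.real (Set.Ioi t) / (1 + t)) (Set.Ioi a)) :
    IntegrableOn (fun x => Real.logb 2 (1 + x) * (ν.rnDeriv volume x).toReal) (Set.Ioi a) := by
  have h := (integrable_toReal_of_lintegral_ne_top (by fun_prop)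
    ((lintegral_rnDeriv_mul_log hν ha hint).trans_ne ENNReal.ofReal_ne_top)).div_const (Real.log 2)
  exact (integrableOn_congr_fun (fun x (hx : a < x) => logb_mul_rnDeriv_eq ν (ha.trans hx.le))
    measurableSet_Ioi).2 h

lemma integral_logb_mul_rnDeriv (hν : ν.restrict (Set.Ioi a) ≪ volume) (ha : 0 ≤ a)
    (hint : IntegrableOn (fun t => ν.real (Set.Ioi t) / (1 + t)) (Set.Ioi a)) :
    ∫ x in Set.Ioi a, Real.logb 2 (1 + x) * (ν.rnDeriv volume x).toReal =
      (ν.real (Set.Ioi a) * Real.log (1 + a) + ∫ t in Set.Ioi a, ν.real (Set.Ioi t) / (1 + t)) /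
        Real.log 2 := by
  have hfin : ∀ᵐ x ∂volume.restrict (Set.Ioi a),
      ν.rnDeriv volume x * ENNReal.ofReal (Real.log (1 + x)) < ∞ :=
    ae_restrict_of_ae <| (ν.rnDeriv_lt_top volume).mono fun x hx =>
      ENNReal.mul_lt_top hx ENNReal.ofReal_lt_top
  rw [setIntegral_congr_fun measurableSet_Ioi fun x (hx : a < x) =>
      logb_mul_rnDeriv_eq ν (ha.trans hx.le), integral_div, integral_toReal (by fun_prop) hfin,
    lintegral_rnDeriv_mul_log hν ha hint, ENNReal.toReal_ofReal]
  exact add_nonneg (mul_nonneg measureReal_nonneg (Real.log_nonneg (by linarith)))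
    (setIntegral_nonneg measurableSet_Ioi fun t (ht : a < t) =>
      div_nonneg measureReal_nonneg (by linarith))

end LayerCake

section ExponentialTail

variable {a c : ℝ}

lemma norm_div_one_add_le_exp {f : ℝ → ℝ} (hf : ∀ t, 0 < t → ‖f t‖ ≤ Real.exp (-c * t))
    (ha : 0 ≤ a) : ∀ᵐ t ∂volume.restrict (Set.Ioi a), ‖f t / (1 + t)‖ ≤ Real.exp (-c * t) := by
  filter_upwards [ae_restrict_mem measurableSet_Ioi] with t (ht : a < t)
  rw [norm_div, Real.norm_of_nonneg (by linarith : 0 ≤ 1 + t)]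
  exact (div_le_self (norm_nonneg _) (by linarith)).trans (hf t (ha.trans_lt ht))

lemma integrableOn_div_one_add_of_le_exp (ha : 0 ≤ a) (hc : 0 < c) {f : ℝ → ℝ}
    (hf : Measurable f) (hfc : ∀ t, 0 < t → ‖f t‖ ≤ Real.exp (-c * t)) :
    IntegrableOn (fun t => f t / (1 + t)) (Set.Ioi a) :=
  (integrableOn_exp_mul_Ioi (neg_neg_of_pos hc) a).mono'
    (hf.div (by fun_prop)).aestronglyMeasurable (norm_div_one_add_le_exp hfc ha)

lemma tendsto_integral_div_one_add_of_le_exp {ι : Type*} {b : Filter ι} [b.IsCountablyGenerated]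
    (ha : 0 ≤ a) (hc : 0 < c) {F : ι → ℝ → ℝ} {f : ℝ → ℝ} (hF : ∀ᶠ i in b, Measurable (F i))
    (hFc : ∀ᶠ i in b, ∀ t, 0 < t → ‖F i t‖ ≤ Real.exp (-c * t))
    (hlim : ∀ t, 0 < t → Tendsto (F · t) b (𝓝 (f t))) :
    Tendsto (fun i => ∫ t in Set.Ioi a, F i t / (1 + t)) b
      (𝓝 (∫ t in Set.Ioi a, f t / (1 + t))) :=
  tendsto_integral_filter_of_dominated_convergence (fun t => Real.exp (-c * t))
    (hF.mono fun i hi => (hi.div (by fun_prop)).aestronglyMeasurable)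
    (hFc.mono fun i hi => norm_div_one_add_le_exp hi ha)
    (integrableOn_exp_mul_Ioi (neg_neg_of_pos hc) a)
    ((ae_restrict_mem measurableSet_Ioi).mono fun t ht =>
      (hlim t (ha.trans_lt ht)).div_const _)

end ExponentialTail

namespace RadioModel

variable {M : RadioModel}

lemma measurable_interfIntegral {p ζ : ℝ → ℝ} (hp : Measurable fun u => p (M.dist3 u))
    (hζ : Measurable ζ) : Measurable (M.interfIntegral p ζ) := by
  have hp' : Measurable fun z : ℝ × ℝ => p (M.dist3 z.2) := hp.comp measurable_snd
  have hζ' : Measurable fun z : ℝ × ℝ => ζ (M.dist3 z.2) :=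
    hζ.comp (M.measurable_dist3.comp measurable_snd)
  have hsζ : Measurable fun z : ℝ × ℝ => z.1 * M.P * ζ (M.dist3 z.2) :=
    (measurable_fst.mul_const _).mul hζ'
  exact (((hp'.mul measurable_snd).mul
    (hsζ.div (hsζ.const_add 1))).ennreal_ofReal).lintegral_prod_right'

namespace Admissible

lemma noiseRate_pos (hM : M.Admissible) (hL : 0 < M.L) : 0 < M.noiseRate :=
  div_pos hM.PN_pos (mul_pos hM.P_pos (hM.peakGain_pos hL))

lemma measurable_coverageLimit (hM : M.Admissible) (ρ : ℝ) : Measurable (M.coverageLimit ρ) := by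
  have hp := hM.measurable_prLoS_dist3
  have hLoS := measurable_interfIntegral hp M.measurable_gainL
  have hNLoS := measurable_interfIntegral (p := fun w => 1 - M.prLoS w) (hp.const_sub 1)
    M.measurable_gainNL
  unfold coverageLimit laplaceLimit
  simp only [expNeg_eq_toReal_nexp]
  fun_prop

lemma norm_coverageLimit_le (hM : M.Admissible) (hL : 0 < M.L) {ρ γ : ℝ} (hρ : 0 ≤ ρ)
    (hγ : 0 ≤ γ) : ‖M.coverageLimit ρ γ‖ ≤ Real.exp (-M.noiseRate * γ) := by
  have hs : 0 ≤ γ / (M.P * M.peakGain) :=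
    div_nonneg hγ (mul_pos hM.P_pos (hM.peakGain_pos hL)).le
  rw [hM.coverageLimit_eq hL hρ hγ, Real.norm_of_nonneg ENNReal.toReal_nonneg]
  refine ENNReal.toReal_le_of_le_ofReal (Real.exp_pos _).le
    ((nexp_antitone le_add_self).trans_eq ?_)
  rw [← ENNReal.ofReal_mul hs, nexp_ofReal (mul_nonneg hs hM.PN_pos.le), noiseRate]
  ring_nf

lemma integrableOn_coverageLimit_div_one_add (hM : M.Admissible) (hL : 0 < M.L) {ρ γ₀ : ℝ}
    (hρ : 0 ≤ ρ) (hγ₀ : 0 ≤ γ₀) :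
    IntegrableOn (fun γ => M.coverageLimit ρ γ / (1 + γ)) (Set.Ioi γ₀) :=
  integrableOn_div_one_add_of_le_exp hγ₀ (hM.noiseRate_pos hL) (hM.measurable_coverageLimit ρ)
    fun _ hγ => hM.norm_coverageLimit_le hL hρ hγ.le

end Admissible

end RadioModel

namespace Network

variable {M : RadioModel}

section Coverage

variable {Ω : Type*} [MeasurableSpace Ω] {X : Network Ω} {μ : Measure Ω}

lemma antitone_coverage [IsFiniteMeasure μ] : Antitone (X.coverage M μ) := fun _ _ h =>
  measureReal_mono fun _ hω => h.trans_lt hω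

namespace IsModel

variable {l ρ γ₀ : ℝ}

lemma measurable_coverage (hX : X.IsModel M μ l ρ) : Measurable (X.coverage M μ) :=
  have := hX.bs_hppp.isProbabilityMeasure
  antitone_coverage.measurable

lemma map_sinr_real_Ioi (hX : X.IsModel M μ l ρ) (hM : M.Admissible) (γ : ℝ) :
    (μ.map (X.sinr M)).real (Set.Ioi γ) = X.coverage M μ γ :=
  map_measureReal_apply (hX.isMeasurable.sinr hM hX.meas_h) measurableSet_Ioi

lemma norm_coverage_le (hX : X.IsModel M μ l ρ) (hM : M.Admissible) (hL : 0 < M.L) {γ : ℝ}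
    (hγ : 0 < γ) : ‖X.coverage M μ γ‖ ≤ Real.exp (-M.noiseRate * γ) := by
  have := hX.bs_hppp.isProbabilityMeasure
  rw [coverage, Real.norm_of_nonneg measureReal_nonneg]
  refine ENNReal.toReal_le_of_le_ofReal (Real.exp_pos _).le ?_
  calc μ {ω | γ < X.sinr M ω}
      = ∫⁻ ω, nexp (ENNReal.ofReal γ * X.load M ω) ∂μ := hX.measure_lt_sinr hM hL hγ
    _ ≤ ∫⁻ _, nexp (ENNReal.ofReal γ * ENNReal.ofReal M.noiseRate) ∂μ :=
        lintegral_mono fun ω => nexp_antitone (by gcongr; exact ofReal_noiseRate_le_load hM hL ω)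
    _ = ENNReal.ofReal (Real.exp (-M.noiseRate * γ)) := by
        rw [lintegral_const, measure_univ, mul_one, ← ENNReal.ofReal_mul hγ.le,
          nexp_ofReal (mul_pos hγ (hM.noiseRate_pos hL)).le, neg_mul, mul_comm]

lemma integrableOn_coverage_div_one_add (hX : X.IsModel M μ l ρ) (hM : M.Admissible)
    (hL : 0 < M.L) (hγ₀ : 0 ≤ γ₀) :
    IntegrableOn (fun γ => X.coverage M μ γ / (1 + γ)) (Set.Ioi γ₀) :=
  integrableOn_div_one_add_of_le_exp hγ₀ (hM.noiseRate_pos hL) hX.measurable_coverage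
    fun _ hγ => hX.norm_coverage_le hM hL hγ

lemma map_sinr_restrict_Ioi_absolutelyContinuous (hX : X.IsModel M μ l ρ) (hM : M.Admissible)
    (hL : 0 < M.L) (hγ₀ : 0 ≤ γ₀) : (μ.map (X.sinr M)).restrict (Set.Ioi γ₀) ≪ volume :=
  (Measure.restrict_mono (Set.Ioi_subset_Ioi hγ₀) le_rfl).absolutelyContinuous.trans
    (hX.map_sinr_restrict_absolutelyContinuous hM hL)

lemma integrableOn_rateDensity (hX : X.IsModel M μ l ρ) (hM : M.Admissible) (hL : 0 < M.L)
    (hγ₀ : 0 ≤ γ₀) : IntegrableOn (X.rateDensity M μ) (Set.Ioi γ₀) := by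
  have := hX.bs_hppp.isProbabilityMeasure
  refine integrableOn_logb_mul_rnDeriv
    (hX.map_sinr_restrict_Ioi_absolutelyContinuous hM hL hγ₀) hγ₀ ?_
  simpa only [hX.map_sinr_real_Ioi hM] using hX.integrableOn_coverage_div_one_add hM hL hγ₀

lemma integral_rateDensity (hX : X.IsModel M μ l ρ) (hM : M.Admissible) (hL : 0 < M.L)
    (hγ₀ : 0 ≤ γ₀) :
    ∫ γ in Set.Ioi γ₀, X.rateDensity M μ γ = (X.coverage M μ γ₀ * Real.log (1 + γ₀) +
      ∫ γ in Set.Ioi γ₀, X.coverage M μ γ / (1 + γ)) / Real.log 2 := by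
  have := hX.bs_hppp.isProbabilityMeasure
  have h := integral_logb_mul_rnDeriv (ν := μ.map (X.sinr M))
    (hX.map_sinr_restrict_Ioi_absolutelyContinuous hM hL hγ₀) hγ₀
    (by simpa only [hX.map_sinr_real_Ioi hM] using
      hX.integrableOn_coverage_div_one_add hM hL hγ₀)
  simp only [hX.map_sinr_real_Ioi hM] at h
  exact h

end IsModel

end Coverage

variable {ρ γ₀ : ℝ} {Ω : ℝ → Type*} [∀ l, MeasurableSpace (Ω l)] {μ : ∀ l, Measure (Ω l)}
  {X : ∀ l, Network (Ω l)}

lemma tendsto_integral_coverage_div_one_add (hM : M.Admissible) (hL : 0 < M.L) (hρ : 0 < ρ)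
    (hX : ∀ l, 0 < l → (X l).IsModel M (μ l) l ρ) (hγ₀ : 0 ≤ γ₀) :
    Tendsto (fun l => ∫ γ in Set.Ioi γ₀, (X l).coverage M (μ l) γ / (1 + γ)) atTop
      (𝓝 (∫ γ in Set.Ioi γ₀, M.coverageLimit ρ γ / (1 + γ))) :=
  tendsto_integral_div_one_add_of_le_exp hγ₀ (hM.noiseRate_pos hL)
    ((eventually_gt_atTop 0).mono fun l hl => (hX l hl).measurable_coverage)
    ((eventually_gt_atTop 0).mono fun l hl _ hγ => (hX l hl).norm_coverage_le hM hL hγ)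
    fun _ hγ => tendsto_coverage hM hL hρ hX hγ

lemma tendsto_ase (hM : M.Admissible) (hL : 0 < M.L) (hρ : 0 < ρ)
    (hX : ∀ l, 0 < l → (X l).IsModel M (μ l) l ρ) (hγ₀ : 0 ≤ γ₀) :
    Tendsto (fun l => (X l).ase M (μ l) l ρ γ₀) atTop
      (𝓝 (ρ / Real.log 2 * (∫ γ in Set.Ioi γ₀, M.coverageLimit ρ γ / (1 + γ)) +
        ρ * Real.logb 2 (1 + γ₀) * M.coverageLimit ρ γ₀)) := by
  have hedge : Tendsto (fun l => (X l).coverage M (μ l) γ₀ * Real.log (1 + γ₀)) atTop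
      (𝓝 (M.coverageLimit ρ γ₀ * Real.log (1 + γ₀))) := by
    rcases hγ₀.eq_or_lt with rfl | h
    · simp
    · exact (tendsto_coverage hM hL hρ hX h).mul_const _
  have hlim := (hM.tendsto_activeDensity ρ).mul
    ((hedge.add (tendsto_integral_coverage_div_one_add hM hL hρ hX hγ₀)).div_const (Real.log 2))
  convert hlim.congr' ?_ using 2
  · rw [Real.logb]
    ring
  · filter_upwards [eventually_gt_atTop 0] with l hl
    rw [ase, (hX l hl).integral_rateDensity hM hL hγ₀]

end Network

theorem theorem3
    (M : RadioModel) (hM : M.Admissible) (hL : 0 < M.L)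
    (ρ : ℝ) (hρ : 0 < ρ) (γ₀ : ℝ) (hγ₀ : 0 ≤ γ₀)
    {Ω : ℝ → Type*} [∀ l, MeasurableSpace (Ω l)]
    (μ : ∀ l, Measure (Ω l)) [∀ l, IsProbabilityMeasure (μ l)]
    (X : ∀ l, Network (Ω l)) (hX : ∀ l, 0 < l → (X l).IsModel M (μ l) l ρ) :
    Tendsto (fun l => M.activeDensity ρ l) atTop (𝓝 ρ) ∧
    (∀ γ, 0 < γ →
      Tendsto (fun l => (X l).coverage M (μ l) γ) atTop (𝓝 (M.coverageLimit ρ γ))) ∧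
    (∀ l, 0 < l → IntegrableOn ((X l).rateDensity M (μ l)) (Set.Ioi γ₀)) ∧
    IntegrableOn (fun γ => M.coverageLimit ρ γ / (1 + γ)) (Set.Ioi γ₀) ∧
    Tendsto (fun l => (X l).ase M (μ l) l ρ γ₀) atTop
      (𝓝 (ρ / Real.log 2 * (∫ γ in Set.Ioi γ₀, M.coverageLimit ρ γ / (1 + γ)) +
        ρ * Real.logb 2 (1 + γ₀) * M.coverageLimit ρ γ₀)) := by
  exact ⟨hM.tendsto_activeDensity ρ, fun _ hγ => Network.tendsto_coverage hM hL hρ hX hγ,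
    fun l hl => (hX l hl).integrableOn_rateDensity hM hL hγ₀,
    hM.integrableOn_coverageLimit_div_one_add hL hρ.le hγ₀, Network.tendsto_ase hM hL hρ hX hγ₀⟩
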